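/- Let $\alpha_0,\beta_0\in\mathbb R$, let $\beta\in\mathcal S(\mathbb R)$ be a real-valued Schwartz function, and let $0<\delta<1/8$. Fix a smooth dyadic partition of unity in frequency: smooth compactly supported $p_1,p_0:\mathbb R\to\mathbb R$ with $p_1=1$ and $p_0=0$ near $0$, such that, with $p_\lambda(\xi)=p_0(\lambda^{-1}\xi)$ for $\lambda=2^j$, $j\ge1$, one has $\sum_{\lambda=2^j,\,j\geq 0}p_\lambda(\xi)=1$ for all $\xi$. Let $P_\lambda$ be convolution with the kernel $\frac1{2\pi}\int_{\mathbb R} e^{iy\xi}p_\lambda(\xi)\,d\xi$, let $P_{\le\rho}=\sum_{\lambda=2^j,\ 1\le\lambda\le\rho}P_\lambda$, and for $\rho\ge1$ put $$\|f\|_{B^\infty_\rho}=\|P_{\le\rho}f\|_{L^\infty}+\sum_{\lambda=2^j\ge\rho}\ln|\lambda/\rho|\,\|P_\lambda f\|_{L^\infty},\qquad \|f\|_{H^1}=\|f\|_{L^2}+\|\partial_yf\|_{L^2}.$$ Norms of tuples are sums of the norms of the entries, and $\dot v=\partial_\rho v$. Then there is a constant $C$, depending only on $\alpha_0,\beta_0,\beta,\delta$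 and the partition of unity, with the following property. Let $T\ge1$ and let the real-valued function $v(\rho,y)$ be smooth near $[1,T]\times\mathbb R$ and solve, on $[1,T]\times\mathbb R$, $$\Big(\partial_\rho^2-\frac1{\rho^2}\partial_y^2+1+\frac1{4\rho^2}\Big)v=\frac{\alpha_0}{\rho^{1/2}}v^2+\frac{\beta(\rho y)}{\rho}v^3+\frac{\beta_0}{\rho}v^3+\frac1\rho\big(\beta(\rho\sinh y)-\beta(\rho y)\big)v^3,$$ that is, the Klein--Gordon equation $\partial_t^2u-\partial_x^2u+u=\alpha_0u^2+(\beta_0+\beta(x))u^3$ for $v=\rho^{1/2}u$ in the coordinates $x=\rho\sinh y$, $t=\rho\cosh y$. If $$K=\sup_{1\le\rho\le T}\rho^{-\delta}\,\big\|(v,\dot v,\rho^{-1}\partial_yv)(\rho)\big\|_{H^1}<\infty,$$ then $$\sup_{1\le\rho\le T}\big\|(v,\dot v,\rho^{-1/2-\delta}\partial_yv)(\rho)\big\|_{B^\infty_\rho}\le C\,K(1+K^2).$$ -/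

import Mathlib

open Set MeasureTheory Topology
open scoped NNReal ENNReal ContDiff SchwartzMap

noncomputable section

/-! ### Littlewood-Paley decompositions on the line -/

/-- The symbol `p_λ` of frequency `λ = 2 ^ j`: `low` for `λ = 1` and `ξ ↦ ann (λ⁻¹ ξ)` for `λ ≥ 2`. -/
def dyadicSymbol (low ann : ℝ → ℝ) : ℕ → ℝ → ℝ
  | 0 => low
  | j + 1 => fun ξ => ann (((2 : ℝ) ^ (j + 1))⁻¹ * ξ)

/-- A smooth inhomogeneous dyadic partition of unity in the frequency variable: `low` is a smooth
cutoff which is `1` near the origin, `ann` is a smooth cutoff to an annulus, and the symbols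
`p_1 = low`, `p_λ(ξ) = ann (λ⁻¹ ξ)` (`λ = 2, 4, 8, …`) add up to `1`. -/
structure LittlewoodPaley where
  low : ℝ → ℝ
  ann : ℝ → ℝ
  low_smooth : ContDiff ℝ ∞ low
  low_compact : HasCompactSupport low
  low_eq_one : ∀ᶠ ξ in 𝓝 (0 : ℝ), low ξ = 1
  ann_smooth : ContDiff ℝ ∞ ann
  ann_compact : HasCompactSupport ann
  ann_eq_zero : ∀ᶠ ξ in 𝓝 (0 : ℝ), ann ξ = 0
  partition : ∀ ξ : ℝ, HasSum (fun j : ℕ => dyadicSymbol low ann j ξ) 1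

/-- The convolution kernel `(2π)⁻¹ ∫ e^{i y ξ} p(ξ) dξ` of the Fourier multiplier with symbol `p`,
where the Fourier transform is normalized as `v̂(ξ) = ∫ e^{-i ξ y} v(y) dy`. -/
def multiplierKernel (p : ℝ → ℝ) (y : ℝ) : ℂ :=
  (2 * (Real.pi : ℂ))⁻¹ * ∫ ξ : ℝ, Complex.exp (Complex.I * (y : ℂ) * (ξ : ℂ)) * (p ξ : ℂ)

/-- The Littlewood-Paley projection `P_λ f` at the frequency `λ = 2 ^ j`. -/
def LittlewoodPaley.proj (P : LittlewoodPaley) (j : ℕ) (f : ℝ → ℝ) (y : ℝ) : ℂ :=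
  ∫ z : ℝ, multiplierKernel (dyadicSymbol P.low P.ann j) (y - z) * (f z : ℂ)

/-- The projection `P_{≤ ρ} f`, the sum of `P_λ f` over all dyadic `λ = 2 ^ j` with
`1 ≤ λ ≤ ρ` (for `ρ ≥ 1`; see `mem_range_log_iff`). -/
def LittlewoodPaley.projLE (P : LittlewoodPaley) (ρ : ℝ) (f : ℝ → ℝ) (y : ℝ) : ℂ :=
  ∑ j ∈ Finset.range (Nat.log 2 ⌊ρ⌋₊ + 1), P.proj j f y

/-- The index set of `LittlewoodPaley.projLE` consists of the `j` with `2 ^ j ≤ ρ`. -/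
theorem mem_range_log_iff {ρ : ℝ} (hρ : 1 ≤ ρ) (j : ℕ) :
    j ∈ Finset.range (Nat.log 2 ⌊ρ⌋₊ + 1) ↔ (2 : ℝ) ^ j ≤ ρ := by
  have h0 : ⌊ρ⌋₊ ≠ 0 := (Nat.floor_pos.mpr hρ).ne'
  rw [Finset.mem_range, Nat.lt_succ_iff, Nat.le_log_iff_pow_le (by norm_num) h0,
    Nat.le_floor_iff (by linarith)]
  norm_num

/-- The norm `‖f‖_{B^∞_ρ} = ‖P_{≤ ρ} f‖_{L^∞} + ∑_{λ ≥ ρ} ln |λ / ρ| ‖P_λ f‖_{L^∞}`, the sum being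
over the dyadic `λ = 2 ^ j ≥ ρ`; it takes values in `[0, ∞]`. -/
def LittlewoodPaley.besovNorm (P : LittlewoodPaley) (ρ : ℝ) (f : ℝ → ℝ) : ℝ≥0∞ :=
  eLpNorm (P.projLE ρ f) ⊤ volume +
    ∑' j : {j : ℕ // ρ ≤ (2 : ℝ) ^ j},
      ENNReal.ofReal (Real.log |(2 : ℝ) ^ (j : ℕ) / ρ|) * eLpNorm (P.proj j f) ⊤ volume

/-! ### Energy norms and the equation -/

/-- The norm `‖f‖_{H^1} = ‖f‖_{L²} + ‖∂_y f‖_{L²}` of a differentiable function, in `[0, ∞]`. -/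
def sobolevNorm (f : ℝ → ℝ) : ℝ≥0∞ :=
  eLpNorm f 2 volume + eLpNorm (deriv f) 2 volume

/-- `∂_ρ v`, as a function of `ρ` and `y`. -/
def dRho (v : ℝ → ℝ → ℝ) (ρ y : ℝ) : ℝ := deriv (fun r => v r y) ρ

/-- `∂_y v`, as a function of `ρ` and `y`. -/
def dY (v : ℝ → ℝ → ℝ) (ρ y : ℝ) : ℝ := deriv (fun z => v ρ z) y

/-- `v` is a smooth solution, in the slab `[1, T] × ℝ`, of the Klein-Gordon equation
`∂_t² u - ∂_x² u + u = α₀ u² + (β₀ + β(x)) u³` written for `v = ρ^{1/2} u` in the hyperbolic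
coordinates `x = ρ sinh y`, `t = ρ cosh y`. -/
structure IsHyperbolicKGSolution (α₀ β₀ : ℝ) (β : ℝ → ℝ) (T : ℝ) (v : ℝ → ℝ → ℝ) : Prop where
  smooth : ∀ ρ ∈ Icc 1 T, ∀ y : ℝ, ContDiffAt ℝ ∞ (Function.uncurry v) (ρ, y)
  equation : ∀ ρ ∈ Icc 1 T, ∀ y : ℝ,
    dRho (dRho v) ρ y - 1 / ρ ^ 2 * dY (dY v) ρ y + (1 + 1 / (4 * ρ ^ 2)) * v ρ y =
      α₀ / ρ ^ (1 / 2 : ℝ) * v ρ y ^ 2 + β (ρ * y) / ρ * v ρ y ^ 3 + β₀ / ρ * v ρ y ^ 3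
        + 1 / ρ * (β (ρ * Real.sinh y) - β (ρ * y)) * v ρ y ^ 3

/-- `‖(v, v̇, ρ⁻¹ ∂_y v)(ρ)‖_{H^1}`. -/
def energyNorm (v : ℝ → ℝ → ℝ) (ρ : ℝ) : ℝ≥0∞ :=
  sobolevNorm (v ρ) + sobolevNorm (dRho v ρ) + sobolevNorm (fun y => ρ⁻¹ * dY v ρ y)

/-- `K = sup_{1 ≤ ρ ≤ T} ρ^{-δ} ‖(v, v̇, ρ⁻¹ ∂_y v)(ρ)‖_{H^1}`. -/
def energyGrowth (δ T : ℝ) (v : ℝ → ℝ → ℝ) : ℝ≥0∞ :=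
  ⨆ ρ ∈ Icc 1 T, ENNReal.ofReal (ρ ^ (-δ)) * energyNorm v ρ

/-- `‖(v, v̇, ρ^{-1/2-δ} ∂_y v)(ρ)‖_{B^∞_ρ}`. -/
def decayNorm (P : LittlewoodPaley) (δ : ℝ) (v : ℝ → ℝ → ℝ) (ρ : ℝ) : ℝ≥0∞ :=
  P.besovNorm ρ (v ρ) + P.besovNorm ρ (dRho v ρ) +
    P.besovNorm ρ (fun y => ρ ^ (-(1 / 2) - δ) * dY v ρ y)

end

open scoped FourierTransform

/-! The Besov norm is controlled by two simpler quantities: `LittlewoodPaley.exists_besovNorm_le`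
bounds it by sup |f| + ρ^(-1/2) ‖f'‖_{L²}. Low frequencies form one dilated L¹ kernel. At each high
frequency λ the kernel has mean zero, so the 1/2-Hölder continuity of f gains λ^(-1/2), and the
logarithmic weights are then summable. Since ‖f'‖_{L²} ≤ K ρ^δ for f = v, v̇, only sup bounds
remain. For ∂_y v a Sobolev inequality at scale ρ⁻¹ gives 2 K ρ^(1/2+δ).

The sup bounds for v and v̇ (`exists_uniform_bound`) come from the energy of the ODE left after
dropping ρ⁻² ∂_y², averaged with weight 1 - s² over the window y + ρ^(-1/2) s, |s| ≤ 1. Integration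
by parts in s moves one derivative off ∂_y² v, at the price of ρ^(1/2). The resulting ρ^(-3/2) v̇
∂_y v, with v̇ in L^∞ and ∂_y v in L² of the window, costs ρ^(-3/2 + 1/4 + 2δ). The motion of the
window gives terms of the same size, and the remaining ones are no worse. As 2δ - 5/4 < -1, the
averaged energy changes by O(K² + K⁴) over all time. The window is short enough for v and v̇ to
oscillate by only O(K) on it, so the average controls the value at y. -/

/-! ### Kernels of Fourier multipliers -/

theorem multiplierKernel_eq_fourierInv (p : ℝ → ℝ) (y : ℝ) :
    multiplierKernel p y =
      (2 * (Real.pi : ℂ))⁻¹ * 𝓕⁻ (fun ξ : ℝ => (p ξ : ℂ)) ((2 * Real.pi)⁻¹ * y) := by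
  rw [multiplierKernel, Real.fourierInv_eq']
  congr 2 with ξ
  rw [smul_eq_mul]
  congr 2
  have : (Real.pi : ℂ) ≠ 0 := by exact_mod_cast Real.pi_ne_zero
  simp
  field_simp

/-- Integrability, moments and mean of the kernel all follow from writing it as a rescaled Schwartz
function; the mean is Fourier inversion at frequency 0. -/
theorem exists_schwartz_multiplierKernel {p : ℝ → ℝ} (hp : ContDiff ℝ ∞ p)
    (hc : HasCompactSupport p) :
    ∃ g : 𝓢(ℝ, ℂ), (∀ y, multiplierKernel p y =
      (2 * (Real.pi : ℂ))⁻¹ * g ((2 * Real.pi)⁻¹ * y)) ∧ ∫ y, g y = p 0 := by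
  have h1 : HasCompactSupport (fun ξ : ℝ => (p ξ : ℂ)) := hc.comp_left (g := fun x : ℝ => (x : ℂ)) (by simp)
  have h2 : ContDiff ℝ ∞ (fun ξ : ℝ => (p ξ : ℂ)) := Complex.ofRealCLM.contDiff.comp hp
  set f := h1.toSchwartzMap h2 with hf
  have hfc : (f : ℝ → ℂ) = fun ξ : ℝ => (p ξ : ℂ) := rfl
  refine ⟨𝓕⁻ f, fun y => ?_, ?_⟩
  · rw [multiplierKernel_eq_fourierInv, SchwartzMap.fourierInv_coe, hfc]
  · have : (𝓕 (𝓕⁻ f)) 0 = f 0 := by rw [FourierTransform.fourier_fourierInv_eq]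
    rw [SchwartzMap.fourier_coe, Real.fourier_eq'] at this
    simpa [hfc] using this

theorem integrable_multiplierKernel {p : ℝ → ℝ} (hp : ContDiff ℝ ∞ p)
    (hc : HasCompactSupport p) : Integrable (multiplierKernel p) := by
  obtain ⟨g, hg, -⟩ := exists_schwartz_multiplierKernel hp hc
  rw [funext hg]
  exact (g.integrable.comp_mul_left' (by positivity)).const_mul _

theorem integral_multiplierKernel {p : ℝ → ℝ} (hp : ContDiff ℝ ∞ p)
    (hc : HasCompactSupport p) : ∫ y, multiplierKernel p y = p 0 := by
  obtain ⟨g, hg, h0⟩ := exists_schwartz_multiplierKernel hp hc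
  simp_rw [hg]
  have : (Real.pi : ℂ) ≠ 0 := by exact_mod_cast Real.pi_ne_zero
  rw [integral_const_mul, Measure.integral_comp_mul_left (fun y => g y), h0,
    abs_of_pos (by positivity)]
  simp
  field_simp

/-- The weight √|y| is the one met when the kernel acts on increments of a 1/2-Hölder function. -/
theorem integrable_sqrt_mul_multiplierKernel {p : ℝ → ℝ} (hp : ContDiff ℝ ∞ p)
    (hc : HasCompactSupport p) :
    Integrable (fun y => √|y| * ‖multiplierKernel p y‖) := by
  obtain ⟨g, hg, -⟩ := exists_schwartz_multiplierKernel hp hc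
  have h1 := (g.integrable_pow_mul volume 1).comp_mul_left' (R := (2 * Real.pi)⁻¹) (by positivity)
  have h2 := (integrable_multiplierKernel hp hc)
  have hcont : Continuous (multiplierKernel p) := by
    rw [funext hg]; have := g.continuous; fun_prop
  refine ((h1.const_mul 1).add h2.norm).mono' (by fun_prop) (ae_of_all _ fun y => ?_)
  have hs : √|y| ≤ 1 + |y| := by
    rw [Real.sqrt_le_left (by positivity)]; nlinarith [abs_nonneg y]
  have h3 : ‖multiplierKernel p y‖ = (2 * Real.pi)⁻¹ * ‖g ((2 * Real.pi)⁻¹ * y)‖ := by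
    rw [hg]; simp [abs_of_pos Real.pi_pos]
  have h4 : ‖(2 * Real.pi)⁻¹ * y‖ = (2 * Real.pi)⁻¹ * |y| := by
    rw [norm_mul, Real.norm_of_nonneg (by positivity), Real.norm_eq_abs]
  simp only [Pi.add_apply, pow_one, h4, h3, one_mul]
  rw [Real.norm_of_nonneg (by positivity)]
  calc _ ≤ (1 + |y|) * ((2 * Real.pi)⁻¹ * ‖g ((2 * Real.pi)⁻¹ * y)‖) := by gcongr
    _ = _ := by ring

theorem multiplierKernel_dilate {p : ℝ → ℝ} {l : ℝ} (hl : 0 < l) (y : ℝ) :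
    multiplierKernel (fun ξ => p (l⁻¹ * ξ)) y = l * multiplierKernel p (l * y) := by
  have := Measure.integral_comp_mul_left
    (fun ξ : ℝ => Complex.exp (Complex.I * ((l * y : ℝ) : ℂ) * (ξ : ℂ)) * (p ξ : ℂ)) l⁻¹
  have hlc : (l : ℂ) ≠ 0 := by exact_mod_cast hl.ne'
  rw [multiplierKernel, multiplierKernel]
  rw [inv_inv, abs_of_pos hl, Complex.real_smul] at this
  rw [mul_left_comm, ← this]
  congr 2 with ξ
  congr 2
  push_cast
  field_simp

theorem sum_multiplierKernel {ι : Type*} (s : Finset ι) {p : ι → ℝ → ℝ}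
    (hp : ∀ i, Continuous (p i)) (hc : ∀ i, HasCompactSupport (p i)) (y : ℝ) :
    ∑ i ∈ s, multiplierKernel (p i) y = multiplierKernel (fun ξ => ∑ i ∈ s, p i ξ) y := by
  simp only [multiplierKernel]
  rw [← Finset.mul_sum, ← integral_finsetSum]
  · congr 2 with ξ
    push_cast
    rw [Finset.mul_sum]
  · intro i _
    have := hp i
    refine Continuous.integrable_of_hasCompactSupport (by fun_prop) ?_
    exact ((hc i).comp_left (g := fun x : ℝ => (x : ℂ)) (by simp)).mul_left

/-! ### Pointwise bounds for the dyadic projections -/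

namespace LittlewoodPaley

variable (P : LittlewoodPaley)

/-- The partitions of unity at ξ and at 2^(-J) ξ have the same tail after a shift of index. Hence
the low projections are a single dilated kernel, with L¹ norm independent of ρ. -/
theorem sum_range_dyadicSymbol (J : ℕ) (ξ : ℝ) :
    ∑ j ∈ Finset.range (J + 1), dyadicSymbol P.low P.ann j ξ = P.low (((2 : ℝ) ^ J)⁻¹ * ξ) := by
  have h1 := (hasSum_nat_add_iff' (J + 1)).mpr (P.partition ξ)
  have h2 := (hasSum_nat_add_iff' 1).mpr (P.partition (((2 : ℝ) ^ J)⁻¹ * ξ))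
  have : (fun j => dyadicSymbol P.low P.ann (j + (J + 1)) ξ) =
      fun j => dyadicSymbol P.low P.ann (j + 1) (((2 : ℝ) ^ J)⁻¹ * ξ) := by
    funext j
    rw [← add_assoc]
    simp only [dyadicSymbol]
    congr 1
    rw [← mul_assoc, ← mul_inv, ← pow_add]
    congr 3
    ring
  rw [this] at h1
  have h3 := h1.unique h2
  simp [dyadicSymbol] at h3 ⊢
  linarith

theorem dyadicSymbol_contDiff (j : ℕ) : ContDiff ℝ ∞ (dyadicSymbol P.low P.ann j) := by
  cases j with
  | zero => exact P.low_smooth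
  | succ j => exact P.ann_smooth.comp (contDiff_const.mul contDiff_id)

theorem dyadicSymbol_hasCompactSupport (j : ℕ) :
    HasCompactSupport (dyadicSymbol P.low P.ann j) := by
  cases j with
  | zero => exact P.low_compact
  | succ j =>
    exact P.ann_compact.comp_homeomorph (Homeomorph.mulLeft₀ (((2 : ℝ) ^ (j + 1))⁻¹) (by positivity))

theorem projLE_eq {f : ℝ → ℝ} (hf : Continuous f) {A : ℝ} (hA : ∀ y, |f y| ≤ A) (ρ y : ℝ) :
    P.projLE ρ f y = ∫ z, (((2 : ℝ) ^ Nat.log 2 ⌊ρ⌋₊ : ℝ) : ℂ) *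
      multiplierKernel P.low ((2 : ℝ) ^ Nat.log 2 ⌊ρ⌋₊ * (y - z)) * (f z : ℂ) := by
  simp only [projLE, proj]
  rw [← integral_finsetSum]
  · congr with z
    rw [← Finset.sum_mul, sum_multiplierKernel _
      (fun j => (P.dyadicSymbol_contDiff j).continuous) P.dyadicSymbol_hasCompactSupport]
    simp_rw [sum_range_dyadicSymbol]
    rw [multiplierKernel_dilate (by positivity)]
  · intro j _
    refine ((integrable_multiplierKernel (P.dyadicSymbol_contDiff j)
      (P.dyadicSymbol_hasCompactSupport j)).comp_sub_left y).mul_bdd (c := A) ?_ ?_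
    · exact (Complex.continuous_ofReal.comp hf).aestronglyMeasurable
    · exact ae_of_all _ fun z => by simpa using hA z

theorem norm_projLE_le {f : ℝ → ℝ} (hf : Continuous f) {A : ℝ} (hA : ∀ y, |f y| ≤ A) (ρ y : ℝ) :
    ‖P.projLE ρ f y‖ ≤ (∫ z, ‖multiplierKernel P.low z‖) * A := by
  set l : ℝ := (2 : ℝ) ^ Nat.log 2 ⌊ρ⌋₊ with hl
  have hl0 : 0 < l := by positivity
  have hint := (integrable_multiplierKernel P.low_smooth P.low_compact).norm
  rw [P.projLE_eq hf hA]
  calc _ ≤ ∫ z, l * ‖multiplierKernel P.low (l * (y - z))‖ * A := by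
        refine norm_integral_le_of_norm_le
          ((((hint.comp_mul_left' hl0.ne').comp_sub_left y).const_mul l).mul_const A)
          (ae_of_all _ fun z => ?_)
        rw [norm_mul, norm_mul, Complex.norm_real, Complex.norm_real, Real.norm_of_nonneg hl0.le]
        gcongr
        exact hA z
    _ = _ := by
        rw [integral_mul_const, integral_const_mul,
          integral_sub_left_eq_self (fun z => ‖multiplierKernel P.low (l * z)‖) volume y,
          Measure.integral_comp_mul_left (fun z => ‖multiplierKernel P.low z‖), abs_of_pos (by positivity), smul_eq_mul]
        field_simp

/-- The kernel has integral `P.ann 0 = 0`, so f(z) may be replaced by f(z) - f(y); dilating by λ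
turns √|z - y| into λ^(-1/2). -/
theorem norm_proj_succ_le {f : ℝ → ℝ} (hf : Continuous f) {A B : ℝ} (hA : ∀ y, |f y| ≤ A)
    (hB : ∀ y z, |f z - f y| ≤ √|z - y| * B) (j : ℕ) (y : ℝ) :
    ‖P.proj (j + 1) f y‖ ≤
      (√(2 ^ (j + 1)))⁻¹ * ((∫ z, √|z| * ‖multiplierKernel P.ann z‖) * B) := by
  set l : ℝ := (2 : ℝ) ^ (j + 1) with hl
  have hl0 : 0 < l := by positivity
  have hint := integrable_sqrt_mul_multiplierKernel P.ann_smooth P.ann_compact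
  have hk := integrable_multiplierKernel P.ann_smooth P.ann_compact
  have hk' := (((hk.comp_mul_left' hl0.ne').comp_sub_left y).const_mul (l : ℂ))
  have h0 : ∫ z, (l : ℂ) * multiplierKernel P.ann (l * (y - z)) = 0 := by
    rw [integral_const_mul,
      integral_sub_left_eq_self (fun z => multiplierKernel P.ann (l * z)) volume y,
      Measure.integral_comp_mul_left (fun z => multiplierKernel P.ann z),
      integral_multiplierKernel P.ann_smooth P.ann_compact, P.ann_eq_zero.self_of_nhds]
    simp
  have h1 : P.proj (j + 1) f y =
      ∫ z, (l : ℂ) * multiplierKernel P.ann (l * (y - z)) * ((f z - f y : ℝ) : ℂ) := by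
    simp only [proj, dyadicSymbol, ← hl]
    simp_rw [multiplierKernel_dilate hl0]
    simp_rw [Complex.ofReal_sub, mul_sub (_ * _ : ℂ)]
    rw [integral_sub, integral_mul_const, h0, zero_mul, sub_zero]
    · refine hk'.mul_bdd (c := A) ?_ (ae_of_all _ fun z => by simpa using hA z)
      exact (Complex.continuous_ofReal.comp hf).aestronglyMeasurable
    · exact hk'.mul_const _
  have hi2 := (((hint.comp_mul_left' hl0.ne').comp_sub_left y).const_mul (√l)).mul_const B
  have hs : √l * √l = l := Real.mul_self_sqrt hl0.le
  have hs0 : 0 < √l := Real.sqrt_pos.mpr hl0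
  rw [h1]
  calc _ ≤ ∫ z, √l * (√|l * (y - z)| * ‖multiplierKernel P.ann (l * (y - z))‖) * B := by
        refine norm_integral_le_of_norm_le hi2 (ae_of_all _ fun z => ?_)
        rw [norm_mul, norm_mul, Complex.norm_real, Complex.norm_real, Real.norm_of_nonneg hl0.le,
          abs_mul, abs_of_pos hl0, Real.sqrt_mul hl0.le, abs_sub_comm y z, Real.norm_eq_abs]
        calc _ ≤ l * ‖multiplierKernel P.ann (l * (y - z))‖ * (√|z - y| * B) := by
              gcongr; exact hB y z
          _ = (√l * √l) * ‖multiplierKernel P.ann (l * (y - z))‖ * (√|z - y| * B) := by rw [hs]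
          _ = _ := by ring
    _ = _ := by
        rw [integral_mul_const, integral_const_mul,
          integral_sub_left_eq_self (fun z => √|l * z| * ‖multiplierKernel P.ann (l * z)‖) volume y,
          Measure.integral_comp_mul_left (fun z => √|z| * ‖multiplierKernel P.ann z‖), abs_of_pos (by positivity), smul_eq_mul]
        have : √l * l⁻¹ = (√l)⁻¹ := by field_simp; nlinarith
        rw [← this]; ring

end LittlewoodPaley

/-! ### Hölder and Sobolev inequalities on the line -/

theorem intervalIntegral_sq_le_of_eLpNorm_le {g : ℝ → ℝ} (hg : Continuous g) {B : ℝ} (hB : 0 ≤ B)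
    (h : eLpNorm g 2 volume ≤ ENNReal.ofReal B) {a b : ℝ} (hab : a ≤ b) :
    ∫ x in a..b, g x ^ 2 ≤ B ^ 2 := by
  have hmem : MemLp g 2 volume :=
    ⟨hg.aestronglyMeasurable, h.trans_lt ENNReal.ofReal_lt_top⟩
  have hi : Integrable (fun x => g x ^ 2) := hmem.integrable_sq
  have h1 : ∫ x, g x ^ 2 ≤ B ^ 2 := by
    have h2 := hmem.eLpNorm_eq_integral_rpow_norm (by norm_num) (by norm_num)
    rw [h2, ENNReal.ofReal_le_ofReal_iff hB] at h
    have h3 : (0 : ℝ) ≤ ∫ x, g x ^ 2 := integral_nonneg fun x => by positivity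
    simp at h
    have h4 := pow_le_pow_left₀ (Real.rpow_nonneg h3 _) h 2
    rw [← Real.rpow_natCast, ← Real.rpow_mul h3] at h4
    simpa using h4
  rw [intervalIntegral.integral_of_le hab]
  exact (setIntegral_le_integral hi (ae_of_all _ fun x => by positivity)).trans h1

/-- Cauchy–Schwarz, from the nonnegativity of the variance of g about its mean m. -/
theorem sq_intervalIntegral_le {g : ℝ → ℝ} (hg : Continuous g) {a b : ℝ} (hab : a ≤ b) :
    (∫ x in a..b, g x) ^ 2 ≤ (b - a) * ∫ x in a..b, g x ^ 2 := by
  rcases hab.eq_or_lt with rfl | hlt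
  · simp
  set I := ∫ x in a..b, g x with hI
  have hL : 0 < b - a := sub_pos.mpr hlt
  set m := I / (b - a) with hm
  have h0 : 0 ≤ ∫ x in a..b, (g x - m) ^ 2 :=
    intervalIntegral.integral_nonneg hab fun x _ => by positivity
  have h1 : ∫ x in a..b, (g x - m) ^ 2 = (∫ x in a..b, g x ^ 2) - 2 * m * I + (b - a) * m ^ 2 := by
    have : ∀ x, (g x - m) ^ 2 = g x ^ 2 - 2 * m * g x + m ^ 2 := fun x => by ring
    simp_rw [this]
    rw [intervalIntegral.integral_add, intervalIntegral.integral_sub,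
      intervalIntegral.integral_const_mul, intervalIntegral.integral_const, smul_eq_mul]
    all_goals exact Continuous.intervalIntegrable (by fun_prop) _ _
  have hmI : m * (b - a) = I := by rw [hm]; field_simp
  have h2 : (b - a) * m ^ 2 = m * I := by rw [← hmI]; ring
  rw [h1, h2] at h0
  have h3 : (b - a) * (m * I) = I ^ 2 := by rw [← hmI]; ring
  nlinarith

theorem abs_sub_le_sqrt_mul {f : ℝ → ℝ} (hf : ContDiff ℝ 1 f) {B : ℝ} (hB : 0 ≤ B)
    (h : eLpNorm (deriv f) 2 volume ≤ ENNReal.ofReal B) (y z : ℝ) :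
    |f z - f y| ≤ √|z - y| * B := by
  wlog hyz : y ≤ z generalizing y z
  · rw [abs_sub_comm, abs_sub_comm z y]
    exact this z y (le_of_not_ge hyz)
  have hc : Continuous (deriv f) := hf.continuous_deriv le_rfl
  have hint : ∫ x in y..z, deriv f x = f z - f y :=
    intervalIntegral.integral_deriv_eq_sub
      (fun x _ => hf.differentiable (by norm_num) x) (hc.intervalIntegrable _ _)
  have h1 := sq_intervalIntegral_le hc hyz
  have h2 := intervalIntegral_sq_le_of_eLpNorm_le hc hB h hyz
  rw [hint] at h1
  have h3 : 0 ≤ z - y := sub_nonneg.mpr hyz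
  refine abs_le_of_sq_le_sq ?_ (by positivity)
  rw [abs_of_nonneg h3, mul_pow, Real.sq_sqrt h3]
  nlinarith

/-- The Sobolev inequality on the line, at the scale `h`. -/
theorem abs_le_div_sqrt_add {f : ℝ → ℝ} (hf : ContDiff ℝ 1 f) {A B h : ℝ} (hA : 0 ≤ A)
    (hB : 0 ≤ B) (hh : 0 < h) (hfA : eLpNorm f 2 volume ≤ ENNReal.ofReal A)
    (hfB : eLpNorm (deriv f) 2 volume ≤ ENNReal.ofReal B) (y : ℝ) :
    |f y| ≤ A / √h + √h * B := by
  by_contra! hlt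
  have hs : 0 < √h := Real.sqrt_pos.mpr hh
  -- By Hölder continuity |f| ≥ d on [y, y + h]; if d exceeded A / √h, the L² mass there would
  -- exceed A².
  set d := |f y| - √h * B with hd
  have hd1 : A / √h < d := by linarith
  have hd0 : 0 < d := lt_of_le_of_lt (by positivity) hd1
  have h1 := intervalIntegral_sq_le_of_eLpNorm_le hf.continuous hA hfA (a := y) (b := y + h)
    (by linarith)
  have h2 : ∫ x in y..(y + h), d ^ 2 ≤ ∫ x in y..(y + h), f x ^ 2 := by
    refine intervalIntegral.integral_mono_on (by linarith) (by simp)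
      ((hf.continuous.pow 2).intervalIntegrable _ _) fun x hx => ?_
    have h3 := abs_sub_le_sqrt_mul hf hB hfB y x
    have h4 : √|x - y| ≤ √h := by
      apply Real.sqrt_le_sqrt
      rw [abs_of_nonneg (by linarith [hx.1])]; linarith [hx.2]
    have h5 : |f y| ≤ |f x| + |f x - f y| := by
      have := abs_sub_abs_le_abs_sub (f y) (f x)
      rw [abs_sub_comm] at this; linarith
    have h6 := mul_le_mul_of_nonneg_right h4 hB
    rw [← sq_abs (f x)]
    exact pow_le_pow_left₀ hd0.le (by linarith) 2
  rw [intervalIntegral.integral_const, smul_eq_mul, add_sub_cancel_left] at h2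
  have h7 : A < d * √h := (div_lt_iff₀ hs).mp hd1
  have h8 : A ^ 2 < (d * √h) ^ 2 := pow_lt_pow_left₀ h7 hA (by norm_num)
  rw [mul_pow, Real.sq_sqrt hh.le] at h8
  linarith

/-! ### Summation over high frequencies and the Besov norm -/

/-- With x = 2^j / ρ, the bound log x ≤ 4 x^(1/4) leaves 4 x^(-1/4) ρ^(-1/2), which is geometric in
j - n, where n is the least exponent with ρ ≤ 2^n. -/
theorem tsum_log_mul_inv_sqrt_le : ∃ C : ℝ≥0, ∀ ρ : ℝ, 1 ≤ ρ →
    ∑' j : {j : ℕ // ρ ≤ (2 : ℝ) ^ j}, ENNReal.ofReal (Real.log |(2 : ℝ) ^ (j : ℕ) / ρ|) *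
      ENNReal.ofReal (√(2 ^ (j : ℕ)))⁻¹ ≤ C * ENNReal.ofReal (√ρ)⁻¹ := by
  set r : ℝ := ((2 : ℝ) ^ (1 / 4 : ℝ))⁻¹ with hr
  have hr0 : 0 ≤ r := by positivity
  have hr1 : r < 1 := inv_lt_one_of_one_lt₀ (Real.one_lt_rpow (by norm_num) (by norm_num))
  have hsum : ∑' i : ℕ, ENNReal.ofReal (4 * r ^ i) ≠ ⊤ := by
    have : Summable fun i : ℕ => 4 * r ^ i := (summable_geometric_of_lt_one hr0 hr1).mul_left 4
    exact this.tsum_ofReal_ne_top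
  refine ⟨(∑' i : ℕ, ENNReal.ofReal (4 * r ^ i)).toNNReal, fun ρ hρ => ?_⟩
  rw [ENNReal.coe_toNNReal hsum]
  have hρ0 : 0 < ρ := by linarith
  obtain ⟨n, hn⟩ : ∃ n : ℕ, ∀ j : ℕ, ρ ≤ 2 ^ j ↔ n ≤ j := by
    refine ⟨Nat.clog 2 ⌈ρ⌉₊, fun j => ?_⟩
    rw [Nat.clog_le_iff_le_pow (by norm_num), Nat.ceil_le]
    norm_num
  have hinj : Function.Injective (fun j : {j : ℕ // ρ ≤ (2 : ℝ) ^ j} => (j : ℕ) - n) := by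
    rintro ⟨i, hi⟩ ⟨j, hj⟩ hij
    rw [hn] at hi hj
    simp only at hij
    ext
    simp only
    omega
  rw [← ENNReal.tsum_mul_right]
  refine le_trans (ENNReal.tsum_le_tsum fun j => ?_)
    (ENNReal.tsum_comp_le_tsum_of_injective hinj
      (fun i => ENNReal.ofReal (4 * r ^ i) * ENNReal.ofReal (√ρ)⁻¹))
  obtain ⟨j, hj⟩ := j
  simp only
  have hnj := (hn j).mp hj
  rw [← ENNReal.ofReal_mul' (by positivity), ← ENNReal.ofReal_mul' (by positivity)]
  apply ENNReal.ofReal_le_ofReal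
  set x := (2 : ℝ) ^ j / ρ with hx
  have hx0 : 0 < x := by positivity
  have hxe : (2 : ℝ) ^ j = x * ρ := by rw [hx]; field_simp
  have hxl : (2 : ℝ) ^ (j - n) ≤ x := by
    rw [hx, le_div_iff₀ hρ0]
    calc _ ≤ (2 : ℝ) ^ (j - n) * 2 ^ n := by gcongr; exact (hn n).mpr le_rfl
      _ = 2 ^ j := by rw [← pow_add]; congr 1; omega
  rw [hxe, abs_of_pos hx0, Real.sqrt_mul hx0.le, mul_inv, ← mul_assoc]
  refine mul_le_mul_of_nonneg_right ?_ (by positivity)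
  have h1 : Real.log x ≤ x ^ (1 / 4 : ℝ) / (1 / 4) := Real.log_le_rpow_div hx0.le (by norm_num)
  have h2 : (√x)⁻¹ = (x ^ (1 / 4 : ℝ))⁻¹ * (x ^ (1 / 4 : ℝ))⁻¹ := by
    rw [← mul_inv, ← Real.rpow_add hx0, Real.sqrt_eq_rpow]; norm_num
  have h3 : 0 < x ^ (1 / 4 : ℝ) := by positivity
  have h4 : (x ^ (1 / 4 : ℝ))⁻¹ ≤ r ^ (j - n) := by
    rw [hr, inv_pow, ← Real.rpow_natCast, ← Real.rpow_mul (by norm_num), mul_comm,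
      Real.rpow_mul (by norm_num), Real.rpow_natCast]
    gcongr
  calc Real.log x * (√x)⁻¹ ≤ x ^ (1 / 4 : ℝ) / (1 / 4) * (√x)⁻¹ := by gcongr
    _ = 4 * (x ^ (1 / 4 : ℝ))⁻¹ := by rw [h2]; field_simp
    _ ≤ _ := by gcongr

theorem LittlewoodPaley.exists_besovNorm_le (P : LittlewoodPaley) :
    ∃ C : ℝ, 0 ≤ C ∧ ∀ ρ : ℝ, 1 ≤ ρ → ∀ f : ℝ → ℝ, ContDiff ℝ 1 f → ∀ A B : ℝ, 0 ≤ B →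
      (∀ y, |f y| ≤ A) → eLpNorm (deriv f) 2 volume ≤ ENNReal.ofReal B →
      P.besovNorm ρ f ≤ ENNReal.ofReal (C * (A + (√ρ)⁻¹ * B)) := by
  obtain ⟨S, hS⟩ := tsum_log_mul_inv_sqrt_le
  set c1 := ∫ z, ‖multiplierKernel P.low z‖ with hc1
  set c2 := ∫ z, √|z| * ‖multiplierKernel P.ann z‖ with hc2
  have h1 : 0 ≤ c1 := integral_nonneg fun z => by positivity
  have h2 : 0 ≤ c2 := integral_nonneg fun z => by positivity
  refine ⟨c1 + S * c2, by positivity, fun ρ hρ f hf A B hB hA hfB => ?_⟩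
  have hA0 : 0 ≤ A := (abs_nonneg _).trans (hA 0)
  have hlow : eLpNorm (P.projLE ρ f) ⊤ volume ≤ ENNReal.ofReal (c1 * A) := by
    rw [eLpNorm_exponent_top]
    exact eLpNormEssSup_le_of_ae_bound (ae_of_all _ (P.norm_projLE_le hf.continuous hA ρ))
  have hhigh : ∑' j : {j : ℕ // ρ ≤ (2 : ℝ) ^ j},
      ENNReal.ofReal (Real.log |(2 : ℝ) ^ (j : ℕ) / ρ|) * eLpNorm (P.proj j f) ⊤ volume ≤
      ENNReal.ofReal (S * c2 * ((√ρ)⁻¹ * B)) := by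
    calc _ ≤ ∑' j : {j : ℕ // ρ ≤ (2 : ℝ) ^ j},
          ENNReal.ofReal (Real.log |(2 : ℝ) ^ (j : ℕ) / ρ|) *
            ENNReal.ofReal (√(2 ^ (j : ℕ)))⁻¹ * ENNReal.ofReal (c2 * B) := by
          refine ENNReal.tsum_le_tsum fun j => ?_
          obtain ⟨j, hj⟩ := j
          cases j with
          | zero =>
            -- The symbol `P.low` gives no mean-zero kernel, but λ = 1 ≥ ρ forces ρ = 1 and the
            -- logarithmic weight vanishes.
            have : ρ = 1 := le_antisymm (by simpa using hj) hρ
            simp [this]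
          | succ j =>
            rw [mul_assoc, ← ENNReal.ofReal_mul (by positivity)]
            gcongr
            rw [eLpNorm_exponent_top]
            exact eLpNormEssSup_le_of_ae_bound (ae_of_all _ (P.norm_proj_succ_le hf.continuous hA
              (fun y z => abs_sub_le_sqrt_mul hf hB hfB y z) j))
      _ ≤ S * ENNReal.ofReal (√ρ)⁻¹ * ENNReal.ofReal (c2 * B) := by
          rw [ENNReal.tsum_mul_right]
          gcongr
          exact hS ρ hρ
      _ = _ := by
          rw [← ENNReal.ofReal_coe_nnreal, ← ENNReal.ofReal_mul (by positivity),
            ← ENNReal.ofReal_mul (by positivity)]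
          congr 1; ring
  calc P.besovNorm ρ f ≤ ENNReal.ofReal (c1 * A) + ENNReal.ofReal (S * c2 * ((√ρ)⁻¹ * B)) :=
        add_le_add hlow hhigh
    _ = ENNReal.ofReal (c1 * A + S * c2 * ((√ρ)⁻¹ * B)) :=
        (ENNReal.ofReal_add (by positivity) (by positivity)).symm
    _ ≤ _ := by
        apply ENNReal.ofReal_le_ofReal
        have h3 : 0 ≤ c1 * ((√ρ)⁻¹ * B) := by positivity
        have h4 : 0 ≤ S * c2 * A := by positivity
        nlinarith

/-! ### Partial derivatives and the chain rule along curves -/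

theorem dRho_eq_fderiv {f : ℝ → ℝ → ℝ} {p : ℝ × ℝ}
    (hf : DifferentiableAt ℝ (Function.uncurry f) p) :
    dRho f p.1 p.2 = fderiv ℝ (Function.uncurry f) p (1, 0) := by
  have h1 : HasDerivAt (fun r : ℝ => (r, p.2)) ((1 : ℝ), (0 : ℝ)) p.1 :=
    (hasDerivAt_id _).prodMk (hasDerivAt_const _ _)
  exact (hf.hasFDerivAt.comp_hasDerivAt p.1 h1).deriv

theorem dY_eq_fderiv {f : ℝ → ℝ → ℝ} {p : ℝ × ℝ}
    (hf : DifferentiableAt ℝ (Function.uncurry f) p) :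
    dY f p.1 p.2 = fderiv ℝ (Function.uncurry f) p (0, 1) := by
  have h1 : HasDerivAt (fun r : ℝ => (p.1, r)) ((0 : ℝ), (1 : ℝ)) p.2 :=
    (hasDerivAt_const _ _).prodMk (hasDerivAt_id _)
  exact (hf.hasFDerivAt.comp_hasDerivAt p.2 h1).deriv

theorem ContDiffAt.eventually_differentiableAt {f : ℝ × ℝ → ℝ} {p : ℝ × ℝ}
    (hf : ContDiffAt ℝ ∞ f p) : ∀ᶠ q in 𝓝 p, DifferentiableAt ℝ f q := by
  have h1 : ContDiffAt ℝ 1 f p := hf.of_le (by exact_mod_cast le_top)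
  filter_upwards [h1.eventually (by simp)] with q hq
  exact hq.differentiableAt (by norm_num)

theorem ContDiffAt.uncurry_dRho {f : ℝ → ℝ → ℝ} {p : ℝ × ℝ}
    (hf : ContDiffAt ℝ ∞ (Function.uncurry f) p) :
    ContDiffAt ℝ ∞ (Function.uncurry (dRho f)) p := by
  have h1 : ContDiffAt ℝ ∞ (fun q => fderiv ℝ (Function.uncurry f) q (1, 0)) p :=
    (hf.fderiv_right (m := ∞) (by simp)).clm_apply contDiffAt_const
  refine h1.congr_of_eventuallyEq ?_
  filter_upwards [hf.eventually_differentiableAt] with q hq using dRho_eq_fderiv hq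

theorem ContDiffAt.uncurry_dY {f : ℝ → ℝ → ℝ} {p : ℝ × ℝ}
    (hf : ContDiffAt ℝ ∞ (Function.uncurry f) p) :
    ContDiffAt ℝ ∞ (Function.uncurry (dY f)) p := by
  have h1 : ContDiffAt ℝ ∞ (fun q => fderiv ℝ (Function.uncurry f) q (0, 1)) p :=
    (hf.fderiv_right (m := ∞) (by simp)).clm_apply contDiffAt_const
  refine h1.congr_of_eventuallyEq ?_
  filter_upwards [hf.eventually_differentiableAt] with q hq using dY_eq_fderiv hq

theorem hasDerivAt_along_curve {f : ℝ → ℝ → ℝ} {γ : ℝ → ℝ} {γ' ρ : ℝ}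
    (hf : ContDiffAt ℝ ∞ (Function.uncurry f) (ρ, γ ρ)) (hγ : HasDerivAt γ γ' ρ) :
    HasDerivAt (fun r => f r (γ r)) (dRho f ρ (γ ρ) + γ' * dY f ρ (γ ρ)) ρ := by
  have hd := hf.eventually_differentiableAt.self_of_nhds
  have h1 : HasDerivAt (fun r : ℝ => (r, γ r)) ((1 : ℝ), γ') ρ := (hasDerivAt_id _).prodMk hγ
  have h2 := hd.hasFDerivAt.comp_hasDerivAt ρ h1
  rw [dRho_eq_fderiv hd, dY_eq_fderiv hd, ← smul_eq_mul, ← map_smul, ← map_add]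
  have h3 : ((1 : ℝ), (0 : ℝ)) + γ' • ((0 : ℝ), (1 : ℝ)) = (1, γ') := by simp
  rw [h3]
  exact h2

theorem contDiff_slice {f : ℝ → ℝ → ℝ} {ρ : ℝ}
    (hf : ∀ y, ContDiffAt ℝ ∞ (Function.uncurry f) (ρ, y)) : ContDiff ℝ ∞ (f ρ) :=
  contDiff_iff_contDiffAt.mpr fun y =>
    (hf y).comp y (contDiffAt_const.prodMk contDiffAt_id)

/-! ### The ODE energy along the moving window -/

theorem hasDerivAt_inv_sqrt {ρ : ℝ} (hρ : 0 < ρ) :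
    HasDerivAt (fun r : ℝ => (√r)⁻¹) (-(1 / 2) * (√ρ)⁻¹ ^ 3) ρ := by
  have hs : √ρ ≠ 0 := (Real.sqrt_pos.mpr hρ).ne'
  refine ((Real.hasDerivAt_sqrt hρ.ne').inv hs).congr_deriv ?_
  field_simp

/-- The energy density of the ordinary differential equation obtained by dropping `ρ⁻² ∂_y²`. -/
noncomputable def energyDensity (α₀ β₀ : ℝ) (β : ℝ → ℝ) (v : ℝ → ℝ → ℝ) (ρ y : ℝ) : ℝ :=
  1 / 2 * dRho v ρ y ^ 2 + 1 / 2 * v ρ y ^ 2 - α₀ * (√ρ)⁻¹ / 3 * v ρ y ^ 3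
    - (β₀ + β (ρ * Real.sinh y)) * (√ρ)⁻¹ ^ 2 / 4 * v ρ y ^ 4

/-- The derivative of `energyDensity` along `ρ ↦ (ρ, y)`, without the term containing `∂_y² v`,
plus `-s/2 ρ^{-3/2}` times its derivative in `y`. -/
noncomputable def energyDensityRemainder (α₀ β₀ : ℝ) (β : ℝ → ℝ) (v : ℝ → ℝ → ℝ) (ρ y s : ℝ) : ℝ :=
  -((√ρ)⁻¹ ^ 4 * (v ρ y * dRho v ρ y) / 4) + α₀ * (√ρ)⁻¹ ^ 3 * v ρ y ^ 3 / 6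
    + (β₀ + β (ρ * Real.sinh y)) * (√ρ)⁻¹ ^ 4 * v ρ y ^ 4 / 4
    - ρ * Real.sinh y * deriv β (ρ * Real.sinh y) * (√ρ)⁻¹ ^ 4 * v ρ y ^ 4 / 4
    - 1 / 2 * (√ρ)⁻¹ ^ 3 * s * (dRho v ρ y * dY (dRho v) ρ y + v ρ y * dY v ρ y
      - α₀ * (√ρ)⁻¹ * v ρ y ^ 2 * dY v ρ y
      - (β₀ + β (ρ * Real.sinh y)) * (√ρ)⁻¹ ^ 2 * v ρ y ^ 3 * dY v ρ y
      - deriv β (ρ * Real.sinh y) * Real.cosh y * v ρ y ^ 4 / 4)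

section
variable {α₀ β₀ T : ℝ} {β : ℝ → ℝ} {v : ℝ → ℝ → ℝ}

/-- The cubic terms of the equation combine into β₀ + β(ρ sinh y), so the ODE part of the derivative
cancels. Apart from ∂_y² v there remain the mass correction 1/(4ρ²), the explicit ρ-dependence of
the potential, and the drift of the window. -/
theorem IsHyperbolicKGSolution.hasDerivAt_energyDensity
    (hv : IsHyperbolicKGSolution α₀ β₀ β T v) (hβ : Differentiable ℝ β) {ρ : ℝ} (hρ : ρ ∈ Icc 1 T)
    (y s : ℝ) :
    HasDerivAt (fun r => energyDensity α₀ β₀ β v r (y + (√r)⁻¹ * s))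
      ((√ρ)⁻¹ ^ 4 * (dRho v ρ (y + (√ρ)⁻¹ * s) * dY (dY v) ρ (y + (√ρ)⁻¹ * s))
        + energyDensityRemainder α₀ β₀ β v ρ (y + (√ρ)⁻¹ * s) s) ρ := by
  have hρ0 : 0 < ρ := by linarith [hρ.1]
  have hw := hasDerivAt_inv_sqrt hρ0
  have hγ : HasDerivAt (fun r : ℝ => y + (√r)⁻¹ * s) (-(1 / 2) * (√ρ)⁻¹ ^ 3 * s) ρ :=
    (hw.mul_const s).const_add y
  have hsm := hv.smooth ρ hρ (y + (√ρ)⁻¹ * s)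
  have ha := hasDerivAt_along_curve hsm hγ
  have hb := hasDerivAt_along_curve hsm.uncurry_dRho hγ
  have hB := (((hβ _).hasDerivAt.comp ρ ((hasDerivAt_id ρ).mul hγ.sinh)).const_add β₀)
  have heq := hv.equation ρ hρ (y + (√ρ)⁻¹ * s)
  rw [← Real.sqrt_eq_rpow] at heq
  have hall := ((((hb.pow 2).const_mul (1 / 2)).add ((ha.pow 2).const_mul (1 / 2))).sub
    (((hw.const_mul α₀).div_const 3).mul (ha.pow 3))).sub
      (((hB.mul (hw.pow 2)).div_const 4).mul (ha.pow 4))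
  refine HasDerivAt.congr_deriv hall ?_
  -- Rewriting the equation in w = ρ^(-1/2) makes the final identity polynomial.
  have hwρ : ρ = ((√ρ)⁻¹ ^ 2)⁻¹ := by
    rw [inv_pow, Real.sq_sqrt hρ0.le, inv_inv]
  have hw0 : 0 < (√ρ)⁻¹ := by positivity
  simp only [energyDensityRemainder]
  generalize hz : y + (√ρ)⁻¹ * s = z at *
  have h1 : α₀ / √ρ = α₀ * (√ρ)⁻¹ := div_eq_mul_inv _ _
  rw [h1] at heq
  simp only [Pi.mul_apply, id, Function.comp, Pi.pow_apply, hz]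
  generalize (√ρ)⁻¹ = w at *
  have heq' : dRho (dRho v) ρ z = w ^ 4 * dY (dY v) ρ z - (1 + w ^ 4 / 4) * v ρ z
      + α₀ * w * v ρ z ^ 2 + (β₀ + β (ρ * Real.sinh z)) * w ^ 2 * v ρ z ^ 3 := by
    have h2 : 1 / ρ = w ^ 2 := by rw [hwρ]; field_simp
    have h3 : 1 / ρ ^ 2 = w ^ 4 := by rw [hwρ]; field_simp
    have h4 : 1 / (4 * ρ ^ 2) = w ^ 4 / 4 := by rw [hwρ]; field_simp
    have h5 : ∀ x, x / ρ = x * w ^ 2 := fun x => by rw [← h2]; ring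
    rw [h3, h4, h5, h5, h2] at heq
    linear_combination heq
  rw [heq']
  have h6 : w ^ 2 * ρ = 1 := by rw [hwρ]; field_simp
  generalize β (ρ * Real.sinh z) = B0
  generalize deriv β (ρ * Real.sinh z) = B1
  generalize Real.sinh z = S0
  generalize Real.cosh z = C0
  push_cast
  -- The relation w² ρ = 1 is needed only for the two terms where the chain rule differentiates β(ρ
  -- sinh z).
  linear_combination (-(1/4) * B1 * v ρ z ^ 4 * (-(1/2) * w ^ 3 * s * C0 - S0 * w ^ 2)) * h6

end

/-! ### Pointwise majorant of the energy derivative -/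

/-- The dominating quantity for the derivative of the localized energy at `t = ρ^{-1/4}`. -/
def energyMajorant (t M c d : ℝ) : ℝ :=
  M ^ 2 * t ^ 5 + M ^ 4 * t ^ 6 + (1 + M ^ 2 * t) * t ^ 7 * (c ^ 2 + d ^ 2)

section
variable {t M c d : ℝ}

theorem le_energyMajorant (ht0 : 0 < t) :
    M ^ 2 * t ^ 5 + t ^ 7 * c ^ 2 + t ^ 7 * d ^ 2 ≤ energyMajorant t M c d ∧
      M ^ 2 * t ^ 5 + M ^ 4 * t ^ 6 ≤ energyMajorant t M c d ∧
      M ^ 4 * t ^ 6 + t ^ 7 * c ^ 2 ≤ energyMajorant t M c d ∧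
      M ^ 4 * t ^ 6 + M ^ 2 * t ^ 8 * c ^ 2 ≤ energyMajorant t M c d := by
  have p1 : 0 ≤ M ^ 2 * t ^ 5 := by positivity
  have p2 : 0 ≤ M ^ 4 * t ^ 6 := by positivity
  have p3 : 0 ≤ t ^ 7 * c ^ 2 := by positivity
  have p4 : 0 ≤ t ^ 7 * d ^ 2 := by positivity
  have p5 : 0 ≤ M ^ 2 * t ^ 8 * c ^ 2 := by positivity
  have p6 : 0 ≤ M ^ 2 * t ^ 8 * d ^ 2 := by positivity
  have hS' : energyMajorant t M c d = M ^ 2 * t ^ 5 + M ^ 4 * t ^ 6 + t ^ 7 * c ^ 2 +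
    t ^ 7 * d ^ 2 + M ^ 2 * t ^ 8 * c ^ 2 + M ^ 2 * t ^ 8 * d ^ 2 := by
      rw [energyMajorant]; ring
  rw [hS']
  refine ⟨?_, ?_, ?_, ?_⟩ <;> linarith

/-- These are the monomials of the energy derivative. Here c and d, standing for ∂_y v and ∂_y v̇,
are controlled only in L², so they must end up squared. -/
theorem energyMajorant_bounds (ht0 : 0 < t) (ht1 : t ≤ 1) (hM : 0 ≤ M) (hc : 0 ≤ c) (hd : 0 ≤ d) :
    2 * (t ^ 6 * (M * c)) ≤ energyMajorant t M c d ∧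
      2 * (t ^ 6 * (M * d)) ≤ energyMajorant t M c d ∧
      t ^ 8 * (c * d) ≤ energyMajorant t M c d ∧
      t ^ 8 * M ^ 2 ≤ energyMajorant t M c d ∧
      t ^ 6 * M ^ 3 ≤ energyMajorant t M c d ∧
      t ^ 8 * (M ^ 2 * c) ≤ energyMajorant t M c d ∧
      t ^ 10 * (M ^ 3 * c) ≤ energyMajorant t M c d ∧
      t ^ 6 * M ^ 4 ≤ energyMajorant t M c d := by
  obtain ⟨l1, l2, l3, l4⟩ := le_energyMajorant (t := t) (M := M) (c := c) (d := d) ht0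
  generalize energyMajorant t M c d = S at *
  have q8 : t ^ 8 ≤ t ^ 7 := pow_le_pow_of_le_one ht0.le ht1 (by norm_num)
  have q86 : t ^ 8 ≤ t ^ 6 := pow_le_pow_of_le_one ht0.le ht1 (by norm_num)
  have q85 : t ^ 8 ≤ t ^ 5 := pow_le_pow_of_le_one ht0.le ht1 (by norm_num)
  have q65 : t ^ 6 ≤ t ^ 5 := pow_le_pow_of_le_one ht0.le ht1 (by norm_num)
  have q106 : t ^ 10 ≤ t ^ 6 := pow_le_pow_of_le_one ht0.le ht1 (by norm_num)
  have q108 : t ^ 10 ≤ t ^ 8 := pow_le_pow_of_le_one ht0.le ht1 (by norm_num)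
  have p1 : 0 ≤ M ^ 2 * t ^ 5 := by positivity
  have p2 : 0 ≤ M ^ 4 * t ^ 6 := by positivity
  have p3 : 0 ≤ t ^ 7 * c ^ 2 := by positivity
  have p4 : 0 ≤ t ^ 7 * d ^ 2 := by positivity
  have hcd : c * d ≤ c ^ 2 + d ^ 2 := by
    have h1 := two_mul_le_add_sq c d
    have h2 := mul_nonneg hc hd
    linarith
  have hMc : M * c ≤ M ^ 2 + c ^ 2 := by
    have h1 := two_mul_le_add_sq M c
    have h2 := mul_nonneg hM hc
    linarith
  have hMMc : M ^ 2 * c ≤ M ^ 4 + c ^ 2 := by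
    have h1 := two_mul_le_add_sq (M ^ 2) c
    have h2 : 0 ≤ M ^ 2 * c := by positivity
    have h3 : (M ^ 2) ^ 2 = M ^ 4 := by ring
    linarith
  have hM3 : M ^ 3 ≤ M ^ 2 + M ^ 4 := by
    have h : 0 ≤ M ^ 2 * (M - 1) ^ 2 + M ^ 3 := by positivity
    linarith
  refine ⟨?_, ?_, ?_, ?_, ?_, ?_, ?_, ?_⟩
  -- The split t⁶ M c = t⁵ · M · (t c) balances the two squares: averaging c² over the window costs
  -- t⁻², which turns t⁷ into t⁵.
  · have : 0 ≤ t ^ 5 * (M - t * c) ^ 2 := by positivity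
    linarith
  · have : 0 ≤ t ^ 5 * (M - t * d) ^ 2 := by positivity
    linarith
  · have : t ^ 8 * (c * d) ≤ t ^ 7 * (c ^ 2 + d ^ 2) := by gcongr
    linarith
  · have : t ^ 8 * M ^ 2 ≤ t ^ 5 * M ^ 2 := by gcongr
    linarith
  · have h1 : t ^ 6 * M ^ 2 ≤ t ^ 5 * M ^ 2 := by gcongr
    have h2 : t ^ 6 * M ^ 3 ≤ t ^ 6 * (M ^ 2 + M ^ 4) := by gcongr
    linarith
  · have e1 : t ^ 8 * M ^ 4 ≤ t ^ 6 * M ^ 4 := by gcongr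
    have e2 : t ^ 8 * c ^ 2 ≤ t ^ 7 * c ^ 2 := by gcongr
    have : t ^ 8 * (M ^ 2 * c) ≤ t ^ 8 * (M ^ 4 + c ^ 2) := by gcongr
    linarith
  · have e1 : t ^ 10 * M ^ 4 ≤ t ^ 6 * M ^ 4 := by gcongr
    have e2 : t ^ 10 * (M ^ 2 * c ^ 2) ≤ t ^ 8 * (M ^ 2 * c ^ 2) := by gcongr
    have : t ^ 10 * (M ^ 2 * (M * c)) ≤ t ^ 10 * (M ^ 2 * (M ^ 2 + c ^ 2)) := by gcongr
    linarith
  · linarith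

end

/-- A bound for the integrand of the derivative of the localized energy. -/
theorem abs_energy_integrand_le {t M s a b c d α B X Y A : ℝ} (ht0 : 0 < t) (ht1 : t ≤ 1)
    (hA : 1 ≤ A) (hs : |s| ≤ 1) (ha : |a| ≤ M) (hb : |b| ≤ M) (hα : |α| ≤ A) (hB : |B| ≤ A)
    (hX : |X| ≤ A) (hY : |Y| ≤ A) :
    |2 * s * (t ^ 2) ^ 3 * (b * c) - (1 - s ^ 2) * (t ^ 2) ^ 4 * (c * d) + (1 - s ^ 2) *
      (-((t ^ 2) ^ 4 * (a * b) / 4) + α * (t ^ 2) ^ 3 * a ^ 3 / 6 + B * (t ^ 2) ^ 4 * a ^ 4 / 4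
        - X * (t ^ 2) ^ 4 * a ^ 4 / 4 - 1 / 2 * (t ^ 2) ^ 3 * s * (b * d + a * c
          - α * t ^ 2 * a ^ 2 * c - B * (t ^ 2) ^ 2 * a ^ 3 * c - Y * a ^ 4 / 4))| ≤
      11 * A * energyMajorant t M c d := by
  have hM : 0 ≤ M := (abs_nonneg a).trans ha
  have hmaj : energyMajorant t M |c| |d| = energyMajorant t M c d := by
    simp only [energyMajorant, sq_abs]
  obtain ⟨h1, h2, h3, h4, h5, h7, h8, h9⟩ :=
    energyMajorant_bounds ht0 ht1 hM (abs_nonneg c) (abs_nonneg d)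
  rw [hmaj] at h1 h2 h3 h4 h5 h7 h8 h9
  generalize energyMajorant t M c d = S at *
  have hS0 : 0 ≤ S := le_trans (by positivity) h9
  have h6 : t ^ 8 * M ^ 4 ≤ S := by
    have : t ^ 8 * M ^ 4 ≤ t ^ 6 * M ^ 4 := by
      gcongr ?_ * _
      exact pow_le_pow_of_le_one ht0.le ht1 (by norm_num)
    linarith
  have hSA : S ≤ A * S := le_mul_of_one_le_left hS0 hA
  have hφ : |1 - s ^ 2| ≤ 1 := by
    have : s ^ 2 ≤ 1 := by rw [← sq_abs]; exact pow_le_one₀ (abs_nonneg s) hs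
    rw [abs_of_nonneg (by linarith)]; linarith [sq_nonneg s]
  have key1 : |2 * s * (t ^ 2) ^ 3 * (b * c)| ≤ S := by
    calc _ = |s| * (2 * (t ^ 6 * (|b| * |c|))) := by
          simp only [abs_mul, abs_pow, abs_of_pos ht0, abs_two]; ring
      _ ≤ 1 * (2 * (t ^ 6 * (M * |c|))) := by gcongr
      _ ≤ S := by linarith
  have key2 : |(t ^ 2) ^ 4 * (c * d)| ≤ S := by
    simp only [abs_mul, abs_pow, abs_of_pos ht0]; linarith
  have key3 : |(t ^ 2) ^ 4 * (a * b)| ≤ S := by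
    calc _ = t ^ 8 * (|a| * |b|) := by simp only [abs_mul, abs_pow, abs_of_pos ht0]; ring
      _ ≤ t ^ 8 * (M * M) := by gcongr
      _ ≤ S := by linarith
  have key4 : |α * (t ^ 2) ^ 3 * a ^ 3| ≤ A * S := by
    calc _ = |α| * (t ^ 6 * |a| ^ 3) := by simp only [abs_mul, abs_pow, abs_of_pos ht0]; ring
      _ ≤ A * (t ^ 6 * M ^ 3) := by gcongr
      _ ≤ A * S := by gcongr
  have key5 : ∀ Z, |Z| ≤ A → |Z * (t ^ 2) ^ 4 * a ^ 4| ≤ A * S := fun Z hZ => by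
    calc _ = |Z| * (t ^ 8 * |a| ^ 4) := by simp only [abs_mul, abs_pow, abs_of_pos ht0]; ring
      _ ≤ A * (t ^ 8 * M ^ 4) := by gcongr
      _ ≤ A * S := by gcongr
  have key6 : |t ^ 6 * (b * d)| ≤ S := by
    calc _ = t ^ 6 * (|b| * |d|) := by simp only [abs_mul, abs_pow, abs_of_pos ht0]
      _ ≤ t ^ 6 * (M * |d|) := by gcongr
      _ ≤ S := by linarith
  have key7 : |t ^ 6 * (a * c)| ≤ S := by
    calc _ = t ^ 6 * (|a| * |c|) := by simp only [abs_mul, abs_pow, abs_of_pos ht0]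
      _ ≤ t ^ 6 * (M * |c|) := by gcongr
      _ ≤ S := by linarith
  have key8 : |t ^ 6 * (α * t ^ 2 * a ^ 2 * c)| ≤ A * S := by
    calc _ = |α| * (t ^ 8 * (|a| ^ 2 * |c|)) := by
          simp only [abs_mul, abs_pow, abs_of_pos ht0]; ring
      _ ≤ A * (t ^ 8 * (M ^ 2 * |c|)) := by gcongr
      _ ≤ A * S := by gcongr
  have key9 : |t ^ 6 * (B * (t ^ 2) ^ 2 * a ^ 3 * c)| ≤ A * S := by
    calc _ = |B| * (t ^ 10 * (|a| ^ 3 * |c|)) := by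
          simp only [abs_mul, abs_pow, abs_of_pos ht0]; ring
      _ ≤ A * (t ^ 10 * (M ^ 3 * |c|)) := by gcongr
      _ ≤ A * S := by gcongr
  have key10 : |t ^ 6 * (Y * a ^ 4)| ≤ A * S := by
    calc _ = |Y| * (t ^ 6 * |a| ^ 4) := by simp only [abs_mul, abs_pow, abs_of_pos ht0]; ring
      _ ≤ A * (t ^ 6 * M ^ 4) := by gcongr
      _ ≤ A * S := by gcongr
  -- U collects the drift of the window; W below collects everything carrying the weight 1 - s²,
  -- leaving only the term where the weight was differentiated.
  set U := t ^ 6 * (b * d) + t ^ 6 * (a * c) - t ^ 6 * (α * t ^ 2 * a ^ 2 * c)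
    - t ^ 6 * (B * (t ^ 2) ^ 2 * a ^ 3 * c) - t ^ 6 * (Y * a ^ 4) / 4 with hU
  have hU5 : |U| ≤ 5 * (A * S) := by
    have k8 := abs_le.mp key8
    have k9 := abs_le.mp key9
    have k10 := abs_le.mp key10
    have k6 := abs_le.mp key6
    have k7 := abs_le.mp key7
    rw [abs_le]
    constructor <;> linarith
  have hsU : |s * U| ≤ 5 * (A * S) := by
    rw [abs_mul]
    calc _ ≤ 1 * |U| := by gcongr
      _ ≤ _ := by linarith
  set W := -((t ^ 2) ^ 4 * (c * d)) - (t ^ 2) ^ 4 * (a * b) / 4 + α * (t ^ 2) ^ 3 * a ^ 3 / 6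
    + B * (t ^ 2) ^ 4 * a ^ 4 / 4 - X * (t ^ 2) ^ 4 * a ^ 4 / 4 - 1 / 2 * (s * U) with hW
  have hW10 : |W| ≤ 10 * (A * S) := by
    have k2 := abs_le.mp key2
    have k3 := abs_le.mp key3
    have k4 := abs_le.mp key4
    have k5 := abs_le.mp (key5 B hB)
    have k5' := abs_le.mp (key5 X hX)
    have ksU := abs_le.mp hsU
    rw [abs_le]
    constructor <;> linarith
  calc _ = |2 * s * (t ^ 2) ^ 3 * (b * c) + (1 - s ^ 2) * W| := by
        congr 1; rw [hW, hU]; ring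
    _ ≤ |2 * s * (t ^ 2) ^ 3 * (b * c)| + |1 - s ^ 2| * |W| := by
        rw [← abs_mul]; exact abs_add_le _ _
    _ ≤ S + 1 * (10 * (A * S)) := by gcongr
    _ ≤ _ := by linarith

/-! ### Averaging over the window -/

/-- Integration by parts against the weight `1 - s²`. -/
theorem integral_weight_mul_eq {b c d e R : ℝ → ℝ} (w y : ℝ) (hb : ∀ z, HasDerivAt b (d z) z)
    (hc : ∀ z, HasDerivAt c (e z) z) (hd : Continuous d) (he : Continuous e)
    (hR : Continuous R) :
    ∫ s in (-1 : ℝ)..1, (1 - s ^ 2) * (w ^ 4 * (b (y + w * s) * e (y + w * s)) + R s) =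
      ∫ s in (-1 : ℝ)..1, (2 * s * w ^ 3 * (b (y + w * s) * c (y + w * s))
        - (1 - s ^ 2) * w ^ 4 * (c (y + w * s) * d (y + w * s)) + (1 - s ^ 2) * R s) := by
  have hbc : Continuous b := continuous_iff_continuousAt.mpr fun z => (hb z).continuousAt
  have hcc : Continuous c := continuous_iff_continuousAt.mpr fun z => (hc z).continuousAt
  rw [← sub_eq_zero, ← intervalIntegral.integral_sub]
  -- The difference of the integrands is an exact derivative, whose primitive vanishes at s = ±1
  -- with the weight.
  · have hder : ∀ s ∈ uIcc (-1 : ℝ) 1, HasDerivAt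
        (fun s => w ^ 3 * ((1 - s ^ 2) * (b (y + w * s) * c (y + w * s))))
        ((1 - s ^ 2) * (w ^ 4 * (b (y + w * s) * e (y + w * s)) + R s) -
          (2 * s * w ^ 3 * (b (y + w * s) * c (y + w * s))
        - (1 - s ^ 2) * w ^ 4 * (c (y + w * s) * d (y + w * s)) + (1 - s ^ 2) * R s)) s := by
      intro s _
      have hz : HasDerivAt (fun s => y + w * s) w s := by
        simpa using ((hasDerivAt_id s).const_mul w).const_add y
      have h1 : HasDerivAt (fun s : ℝ => 1 - s ^ 2) (-(2 * s)) s := by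
        simpa using (hasDerivAt_pow 2 s).const_sub 1
      refine ((h1.mul (((hb _).comp s hz).mul ((hc _).comp s hz))).const_mul (w ^ 3)).congr_deriv ?_
      simp only [Pi.mul_apply, Function.comp]
      ring
    rw [intervalIntegral.integral_eq_sub_of_hasDerivAt hder
      (Continuous.intervalIntegrable (by fun_prop) _ _)]
    norm_num
  all_goals exact Continuous.intervalIntegrable (by fun_prop) _ _

theorem integral_sq_comp_le {g : ℝ → ℝ} (hg : Continuous g) {w B : ℝ} (hw : 0 < w) (hB : 0 ≤ B)
    (h : eLpNorm g 2 volume ≤ ENNReal.ofReal B) (y : ℝ) :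
    ∫ s in (-1 : ℝ)..1, g (y + w * s) ^ 2 ≤ w⁻¹ * B ^ 2 := by
  rw [intervalIntegral.integral_comp_add_mul (fun x => g x ^ 2) hw.ne', smul_eq_mul]
  gcongr
  exact intervalIntegral_sq_le_of_eLpNorm_le hg hB h (by linarith)

theorem integral_weight : ∫ s in (-1 : ℝ)..1, (1 - s ^ 2) = 4 / 3 := by
  rw [intervalIntegral.integral_sub (by simp) (Continuous.intervalIntegrable (by fun_prop) _ _)]
  norm_num

/-- The factor cosh z is harmless since cosh z ≤ 1 + |sinh z| ≤ 1 + |ρ sinh z|, which the decay of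
β' absorbs. -/
theorem exists_coefficient_bound (α₀ β₀ : ℝ) (β : 𝓢(ℝ, ℝ)) :
    ∃ A : ℝ, 1 ≤ A ∧ |α₀| ≤ A ∧ (∀ x, |β₀ + β x| ≤ A) ∧ (∀ x, |x * deriv β x| ≤ A) ∧
      ∀ ρ z : ℝ, 1 ≤ ρ → |deriv β (ρ * Real.sinh z) * Real.cosh z| ≤ A := by
  obtain ⟨C0, h0, hC0⟩ := β.decay 0 0
  obtain ⟨C1, h1, hC1⟩ := (SchwartzMap.derivCLM ℝ ℝ β).decay 0 0
  obtain ⟨C2, h2, hC2⟩ := (SchwartzMap.derivCLM ℝ ℝ β).decay 1 0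
  simp only [pow_zero, norm_iteratedFDeriv_zero, one_mul, pow_one, SchwartzMap.derivCLM_apply,
    Real.norm_eq_abs] at hC0 hC1 hC2
  have hα := abs_nonneg α₀
  have hβ := abs_nonneg β₀
  refine ⟨1 + |α₀| + |β₀| + C0 + C1 + C2, by linarith, by linarith, fun x => ?_, fun x => ?_,
    fun ρ z hρ => ?_⟩
  · linarith [abs_add_le β₀ (β x), hC0 x]
  · rw [abs_mul]; linarith [hC2 x]
  · set x := ρ * Real.sinh z with hx
    have hc : Real.cosh z ≤ 1 + |x| := by
      have h3 : |Real.sinh z| ≤ |x| := by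
        rw [hx, abs_mul, abs_of_pos (by linarith : 0 < ρ)]
        exact le_mul_of_one_le_left (abs_nonneg _) hρ
      have h4 : Real.cosh z ^ 2 ≤ (1 + |Real.sinh z|) ^ 2 := by
        rw [Real.cosh_sq, ← sq_abs (Real.sinh z)]
        linarith [abs_nonneg (Real.sinh z), sq_nonneg (|Real.sinh z|)]
      linarith [abs_le_of_sq_le_sq' h4 (by positivity)]
    rw [abs_mul, abs_of_pos (Real.cosh_pos z)]
    calc _ ≤ |deriv β x| * (1 + |x|) := by gcongr
      _ = |deriv β x| + |x| * |deriv β x| := by ring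
      _ ≤ _ := by linarith [hC1 x, hC2 x]

section
variable {α₀ β₀ T : ℝ} {β : ℝ → ℝ} {v : ℝ → ℝ → ℝ} {ρ M : ℝ}

theorem eLpNorm_le_of_energyNorm_le (h : energyNorm v ρ ≤ ENNReal.ofReal M) :
    eLpNorm (v ρ) 2 volume ≤ ENNReal.ofReal M ∧
      eLpNorm (dY v ρ) 2 volume ≤ ENNReal.ofReal M ∧
      eLpNorm (dRho v ρ) 2 volume ≤ ENNReal.ofReal M ∧
      eLpNorm (dY (dRho v) ρ) 2 volume ≤ ENNReal.ofReal M ∧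
      eLpNorm (deriv fun y => ρ⁻¹ * dY v ρ y) 2 volume ≤ ENNReal.ofReal M := by
  simp only [energyNorm, sobolevNorm] at h
  refine ⟨?_, ?_, ?_, ?_, ?_⟩ <;> refine le_trans ?_ h
  · rw [add_assoc, add_assoc]; exact le_self_add
  · rw [add_assoc, add_assoc]; exact le_add_left le_self_add
  · rw [add_assoc, add_assoc _ _ (eLpNorm _ 2 volume + _)]; exact le_add_left le_self_add
  · exact le_add_right (le_add_left le_add_self)
  · exact le_add_left le_add_self

theorem IsHyperbolicKGSolution.contDiff_slices (hv : IsHyperbolicKGSolution α₀ β₀ β T v)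
    (hρ : ρ ∈ Icc 1 T) :
    ContDiff ℝ ∞ (v ρ) ∧ ContDiff ℝ ∞ (dRho v ρ) ∧ ContDiff ℝ ∞ (dY v ρ) :=
  ⟨contDiff_slice (hv.smooth ρ hρ), contDiff_slice fun y => (hv.smooth ρ hρ y).uncurry_dRho,
    contDiff_slice fun y => (hv.smooth ρ hρ y).uncurry_dY⟩

theorem IsHyperbolicKGSolution.abs_le_of_energyNorm_le (hv : IsHyperbolicKGSolution α₀ β₀ β T v)
    (hρ : ρ ∈ Icc 1 T) (hM : 0 ≤ M) (h : energyNorm v ρ ≤ ENNReal.ofReal M) (y : ℝ) :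
    |v ρ y| ≤ 2 * M ∧ |dRho v ρ y| ≤ 2 * M := by
  obtain ⟨h1, h2, h3, h4, -⟩ := eLpNorm_le_of_energyNorm_le h
  obtain ⟨s1, s2, -⟩ := hv.contDiff_slices hρ
  have e1 := abs_le_div_sqrt_add (s1.of_le (by exact_mod_cast le_top)) hM hM one_pos h1 h2 y
  have e2 := abs_le_div_sqrt_add (s2.of_le (by exact_mod_cast le_top)) hM hM one_pos h3 h4 y
  simp only [Real.sqrt_one, div_one, one_mul] at e1 e2
  constructor <;> linarith

theorem continuousOn_along {f : ℝ → ℝ → ℝ}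
    (hf : ∀ ρ ∈ Icc 1 T, ∀ y, ContDiffAt ℝ ∞ (Function.uncurry f) (ρ, y)) (y : ℝ) :
    ContinuousOn (fun p : ℝ × ℝ => f p.1 (y + (√p.1)⁻¹ * p.2)) (Icc 1 T ×ˢ univ) := by
  rintro ⟨ρ, s⟩ ⟨hρ, -⟩
  simp only at hρ
  have hs : √ρ ≠ 0 := (Real.sqrt_pos.mpr (by linarith [hρ.1])).ne'
  have h1 : ContinuousAt (fun p : ℝ × ℝ => (p.1, y + (√p.1)⁻¹ * p.2)) (ρ, s) := by
    have h3 : ContinuousAt (fun p : ℝ × ℝ => (√p.1)⁻¹) (ρ, s) :=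
      ContinuousAt.inv₀ (by fun_prop) hs
    exact continuousAt_fst.prodMk (continuousAt_const.add (h3.mul continuousAt_snd))
  have h2 : ContinuousAt (Function.uncurry f) (ρ, y + (√ρ)⁻¹ * s) := (hf ρ hρ _).continuousAt
  exact (ContinuousAt.comp (x := (ρ, s)) h2 h1).continuousWithinAt

theorem IsHyperbolicKGSolution.continuousOn_remainder (hv : IsHyperbolicKGSolution α₀ β₀ β T v)
    (hβ : ContDiff ℝ 1 β) (y : ℝ) :
    ContinuousOn (fun p : ℝ × ℝ => energyDensityRemainder α₀ β₀ β v p.1 (y + (√p.1)⁻¹ * p.2) p.2)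
      (Icc 1 T ×ˢ univ) := by
  have key : ∀ a b c d w r z s : ℝ × ℝ → ℝ, ∀ S : Set (ℝ × ℝ), ContinuousOn a S →
      ContinuousOn b S → ContinuousOn c S → ContinuousOn d S → ContinuousOn w S →
      ContinuousOn r S → ContinuousOn z S → ContinuousOn s S → ContinuousOn (fun p =>
      -(w p ^ 4 * (a p * b p) / 4) + α₀ * w p ^ 3 * a p ^ 3 / 6
    + (β₀ + β (r p * Real.sinh (z p))) * w p ^ 4 * a p ^ 4 / 4
    - r p * Real.sinh (z p) * deriv β (r p * Real.sinh (z p)) * w p ^ 4 * a p ^ 4 / 4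
    - 1 / 2 * w p ^ 3 * s p * (b p * d p + a p * c p
      - α₀ * w p * a p ^ 2 * c p
      - (β₀ + β (r p * Real.sinh (z p))) * w p ^ 2 * a p ^ 3 * c p
      - deriv β (r p * Real.sinh (z p)) * Real.cosh (z p) * a p ^ 4 / 4)) S := by
    intro a b c d w r z s S ha hb hc hd hw hr hz hs
    have h1 := hβ.continuous
    have h2 : Continuous (deriv β) := hβ.continuous_deriv le_rfl
    have h3 := Real.continuous_sinh
    have h4 := Real.continuous_cosh
    have e1 : ContinuousOn (fun p => Real.sinh (z p)) S := h3.comp_continuousOn hz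
    have e2 : ContinuousOn (fun p => Real.cosh (z p)) S := h4.comp_continuousOn hz
    have e3 : ContinuousOn (fun p => β (r p * Real.sinh (z p))) S :=
      h1.comp_continuousOn (hr.mul e1)
    have e4 : ContinuousOn (fun p => deriv β (r p * Real.sinh (z p))) S :=
      h2.comp_continuousOn (hr.mul e1)
    fun_prop
  have hw : ContinuousOn (fun p : ℝ × ℝ => (√p.1)⁻¹) (Icc 1 T ×ˢ univ) := by
    refine ContinuousOn.inv₀ (by fun_prop) ?_
    rintro ⟨r, s⟩ ⟨hr, -⟩
    exact (Real.sqrt_pos.mpr (by linarith [hr.1])).ne'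
  exact key _ _ _ _ _ _ _ _ _ (continuousOn_along hv.smooth y)
    (continuousOn_along (fun ρ hρ y => (hv.smooth ρ hρ y).uncurry_dRho) y)
    (continuousOn_along (fun ρ hρ y => (hv.smooth ρ hρ y).uncurry_dY) y)
    (continuousOn_along (fun ρ hρ y => (hv.smooth ρ hρ y).uncurry_dRho.uncurry_dY) y)
    hw continuousOn_fst (continuousOn_const.add (hw.mul continuousOn_snd)) continuousOn_snd

/-- The derivative in `ρ` of `energyDensity` along `ρ ↦ (ρ, y + ρ^{-1/2} s)`. -/
noncomputable def energyDensityDeriv (α₀ β₀ : ℝ) (β : ℝ → ℝ) (v : ℝ → ℝ → ℝ) (y ρ s : ℝ) : ℝ :=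
  (√ρ)⁻¹ ^ 4 * (dRho v ρ (y + (√ρ)⁻¹ * s) * dY (dY v) ρ (y + (√ρ)⁻¹ * s))
    + energyDensityRemainder α₀ β₀ β v ρ (y + (√ρ)⁻¹ * s) s

theorem IsHyperbolicKGSolution.continuousOn_energyDensityDeriv
    (hv : IsHyperbolicKGSolution α₀ β₀ β T v) (hβ : ContDiff ℝ 1 β) (y : ℝ) :
    ContinuousOn (Function.uncurry (energyDensityDeriv α₀ β₀ β v y)) (Icc 1 T ×ˢ univ) := by
  have hw : ContinuousOn (fun p : ℝ × ℝ => (√p.1)⁻¹) (Icc 1 T ×ˢ univ) := by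
    refine ContinuousOn.inv₀ (by fun_prop) ?_
    rintro ⟨r, s⟩ ⟨hr, -⟩
    exact (Real.sqrt_pos.mpr (by linarith [hr.1])).ne'
  exact ((hw.pow 4).mul
    ((continuousOn_along (fun ρ hρ y => (hv.smooth ρ hρ y).uncurry_dRho) y).mul
      (continuousOn_along (fun ρ hρ y => (hv.smooth ρ hρ y).uncurry_dY.uncurry_dY) y))).add
    (hv.continuousOn_remainder hβ y)

theorem continuous_slice_of_continuousOn {F : ℝ × ℝ → ℝ} (hF : ContinuousOn F (Icc 1 T ×ˢ univ))
    (hρ : ρ ∈ Icc 1 T) : Continuous fun s => F (ρ, s) :=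
  hF.comp_continuous (by fun_prop) fun _ => ⟨hρ, mem_univ _⟩

/-- After integration by parts the pointwise majorant applies, with v and v̇ bounded by 2M and their
y-derivatives integrated in L² over the window. -/
theorem IsHyperbolicKGSolution.abs_integral_energyDensityDeriv_le
    (hv : IsHyperbolicKGSolution α₀ β₀ β T v) (hβ : ContDiff ℝ 1 β) {A : ℝ} (hA : 1 ≤ A)
    (hα : |α₀| ≤ A) (hB : ∀ x, |β₀ + β x| ≤ A) (hX : ∀ x, |x * deriv β x| ≤ A)
    (hY : ∀ ρ z : ℝ, 1 ≤ ρ → |deriv β (ρ * Real.sinh z) * Real.cosh z| ≤ A)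
    (hρ : ρ ∈ Icc 1 T) (hM : 0 ≤ M) (h : energyNorm v ρ ≤ ENNReal.ofReal M) {t : ℝ} (ht : 0 < t)
    (htρ : t ^ 2 = (√ρ)⁻¹) (y : ℝ) :
    |∫ s in (-1 : ℝ)..1, (1 - s ^ 2) * energyDensityDeriv α₀ β₀ β v y ρ s| ≤
      44 * A * ((2 * M) ^ 2 * t ^ 5 + (2 * M) ^ 4 * t ^ 6) := by
  obtain ⟨-, hn2, -, hn4, -⟩ := eLpNorm_le_of_energyNorm_le h
  have s1 := fun y => (hv.smooth ρ hρ y)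
  have c2 := contDiff_slice fun y => (s1 y).uncurry_dRho
  have c3 := contDiff_slice fun y => (s1 y).uncurry_dY
  have c4 := contDiff_slice fun y => (s1 y).uncurry_dRho.uncurry_dY
  have c5 := contDiff_slice fun y => (s1 y).uncurry_dY.uncurry_dY
  have hρ1 : 1 ≤ √ρ := Real.one_le_sqrt.mpr hρ.1
  have ht1 : t ≤ 1 := by
    have : t ^ 2 ≤ 1 := by rw [htρ]; exact inv_le_one_of_one_le₀ hρ1
    exact (pow_le_one_iff_of_nonneg ht.le (by norm_num)).mp this
  have hR := continuous_slice_of_continuousOn (hv.continuousOn_remainder hβ y) hρ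
  simp only at hR
  unfold energyDensityDeriv
  rw [integral_weight_mul_eq (b := dRho v ρ) (c := dY v ρ) (d := dY (dRho v) ρ)
    (e := dY (dY v) ρ) (√ρ)⁻¹ y
    (fun z => (c2.differentiable (by simp) z).hasDerivAt)
    (fun z => (c3.differentiable (by simp) z).hasDerivAt) c4.continuous c5.continuous hR]
  have k3 := c3.continuous
  have k4 := c4.continuous
  have i3 := integral_sq_comp_le k3 (pow_pos ht 2) hM hn2 y
  have i4 := integral_sq_comp_le k4 (pow_pos ht 2) hM hn4 y
  rw [← htρ]
  set N := 2 * M with hN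
  have hbd : ∫ s in (-1 : ℝ)..1, 11 * A * energyMajorant t N (dY v ρ (y + t ^ 2 * s))
      (dY (dRho v) ρ (y + t ^ 2 * s)) ≤ 44 * A * (N ^ 2 * t ^ 5 + N ^ 4 * t ^ 6) := by
    simp only [energyMajorant]
    rw [intervalIntegral.integral_const_mul, intervalIntegral.integral_add,
      intervalIntegral.integral_const, intervalIntegral.integral_const_mul,
      intervalIntegral.integral_add, smul_eq_mul]
    rotate_left
    iterate 4 exact Continuous.intervalIntegrable (by fun_prop) _ _
    have hNM : M ^ 2 ≤ N ^ 2 := by rw [hN, mul_pow]; linarith [sq_nonneg M]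
    have h34 : (1 + N ^ 2 * t) * t ^ 7 * ((∫ s in (-1 : ℝ)..1, dY v ρ (y + t ^ 2 * s) ^ 2) +
        ∫ s in (-1 : ℝ)..1, dY (dRho v) ρ (y + t ^ 2 * s) ^ 2) ≤
        (1 + N ^ 2 * t) * t ^ 7 * ((t ^ 2)⁻¹ * N ^ 2 + (t ^ 2)⁻¹ * N ^ 2) := by
      gcongr
      · exact i3.trans (by gcongr)
      · exact i4.trans (by gcongr)
    have h35 : (1 + N ^ 2 * t) * t ^ 7 * ((t ^ 2)⁻¹ * N ^ 2 + (t ^ 2)⁻¹ * N ^ 2) =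
        2 * (N ^ 2 * t ^ 5 + N ^ 4 * t ^ 6) := by
      field_simp
      ring
    rw [h35] at h34
    -- The length 2 of [-1, 1] and the two L² integrals give 11 · (2 + 2) = 44.
    calc _ ≤ 11 * A * ((1 - -1) * (N ^ 2 * t ^ 5 + N ^ 4 * t ^ 6) +
          2 * (N ^ 2 * t ^ 5 + N ^ 4 * t ^ 6)) := by gcongr
      _ = _ := by ring
  refine le_trans ?_ hbd
  rw [← Real.norm_eq_abs]
  refine intervalIntegral.norm_integral_le_of_norm_le (by norm_num) (ae_of_all _ fun s hs => ?_)
    (Continuous.intervalIntegrable (by simp only [energyMajorant]; fun_prop) _ _)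
  have hs1 : |s| ≤ 1 := abs_le.mpr ⟨hs.1.le, hs.2⟩
  obtain ⟨ba, bb⟩ := hv.abs_le_of_energyNorm_le hρ hM h (y + t ^ 2 * s)
  have := abs_energy_integrand_le (c := dY v ρ (y + t ^ 2 * s))
    (d := dY (dRho v) ρ (y + t ^ 2 * s)) ht ht1 hA hs1 ba bb hα
    (hB (ρ * Real.sinh (y + t ^ 2 * s))) (hX (ρ * Real.sinh (y + t ^ 2 * s)))
    (hY ρ (y + t ^ 2 * s) hρ.1)
  simp only [energyDensityRemainder, ← htρ, Real.norm_eq_abs]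
  exact this

end

/-! ### Powers of ρ -/

theorem sq_rpow_neg_quarter {r : ℝ} (hr : 0 < r) : (r ^ (-(1 / 4) : ℝ)) ^ 2 = (√r)⁻¹ := by
  rw [← Real.rpow_natCast, ← Real.rpow_mul hr.le, Real.sqrt_eq_rpow, ← Real.rpow_neg hr.le]
  norm_num

/-- The quartic part decays like r^(4δ - 3/2), which is at most r^(2δ - 5/4) because δ ≤ 1/8. -/
theorem majorant_le_rpow {r K δ : ℝ} (hr : 1 ≤ r) (hδ : δ ≤ 1 / 8) :
    (2 * (K * r ^ δ)) ^ 2 * (r ^ (-(1 / 4) : ℝ)) ^ 5 +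
      (2 * (K * r ^ δ)) ^ 4 * (r ^ (-(1 / 4) : ℝ)) ^ 6 ≤
      16 * (K ^ 2 + K ^ 4) * r ^ (2 * δ - 5 / 4) := by
  have hr0 : 0 < r := by linarith
  have h1 : (r ^ δ) ^ 2 * (r ^ (-(1 / 4) : ℝ)) ^ 5 = r ^ (2 * δ - 5 / 4) := by
    rw [← Real.rpow_natCast, ← Real.rpow_natCast, ← Real.rpow_mul hr0.le, ← Real.rpow_mul hr0.le,
      ← Real.rpow_add hr0]
    congr 1; push_cast; ring
  have h2 : (r ^ δ) ^ 4 * (r ^ (-(1 / 4) : ℝ)) ^ 6 ≤ r ^ (2 * δ - 5 / 4) := by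
    rw [← Real.rpow_natCast, ← Real.rpow_natCast, ← Real.rpow_mul hr0.le, ← Real.rpow_mul hr0.le,
      ← Real.rpow_add hr0]
    apply Real.rpow_le_rpow_of_exponent_le hr
    push_cast; linarith
  have h0 : 0 ≤ r ^ (2 * δ - 5 / 4) := by positivity
  calc _ = 4 * K ^ 2 * ((r ^ δ) ^ 2 * (r ^ (-(1 / 4) : ℝ)) ^ 5) +
        16 * K ^ 4 * ((r ^ δ) ^ 4 * (r ^ (-(1 / 4) : ℝ)) ^ 6) := by ring
    _ ≤ 16 * K ^ 2 * r ^ (2 * δ - 5 / 4) + 16 * K ^ 4 * r ^ (2 * δ - 5 / 4) := by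
        rw [h1]; gcongr; norm_num
    _ = _ := by ring

theorem pow_mul_inv_sqrt_le {r δ : ℝ} (hr : 1 ≤ r) (hδ : δ ≤ 1 / 8) (n : ℕ) (hn : n ≤ 4) :
    (r ^ δ) ^ n * (√r)⁻¹ ≤ 1 := by
  have hr0 : 0 < r := by linarith
  rw [Real.sqrt_eq_rpow, ← Real.rpow_neg hr0.le, ← Real.rpow_natCast, ← Real.rpow_mul hr0.le,
    ← Real.rpow_add hr0]
  apply Real.rpow_le_one_of_one_le_of_nonpos hr
  have h1 : (n : ℝ) ≤ 4 := by exact_mod_cast hn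
  have h2 : (0 : ℝ) ≤ n := by positivity
  nlinarith

theorem integral_rpow_le {ε ρ : ℝ} (hε : 0 < ε) (hρ : 1 ≤ ρ) :
    ∫ r in (1 : ℝ)..ρ, r ^ (-1 - ε) ≤ 1 / ε := by
  rw [integral_rpow (Or.inr ⟨by linarith, by
    rw [uIcc_of_le hρ]; intro h; linarith [h.1]⟩)]
  have h1 : -1 - ε + 1 = -ε := by ring
  rw [h1, Real.one_rpow, div_neg, ← neg_div]
  gcongr
  have : 0 ≤ ρ ^ (-ε) := by positivity
  linarith

section
variable {α₀ β₀ T : ℝ} {β : ℝ → ℝ} {v : ℝ → ℝ → ℝ} {ρ : ℝ}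

theorem IsHyperbolicKGSolution.energyDensity_sub
    (hv : IsHyperbolicKGSolution α₀ β₀ β T v) (hβ : ContDiff ℝ 1 β) (hρ : ρ ∈ Icc 1 T) (y s : ℝ) :
    energyDensity α₀ β₀ β v ρ (y + (√ρ)⁻¹ * s) - energyDensity α₀ β₀ β v 1 (y + (√1)⁻¹ * s) =
      ∫ r in (1 : ℝ)..ρ, energyDensityDeriv α₀ β₀ β v y r s := by
  have hsub : ∀ r ∈ uIcc 1 ρ, r ∈ Icc 1 T := fun r hr => by
    rw [uIcc_of_le hρ.1] at hr; exact ⟨hr.1, hr.2.trans hρ.2⟩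
  refine (intervalIntegral.integral_eq_sub_of_hasDerivAt
    (f := fun r => energyDensity α₀ β₀ β v r (y + (√r)⁻¹ * s)) (fun r hr => ?_) ?_).symm
  · exact hv.hasDerivAt_energyDensity (hβ.differentiable (by norm_num)) (hsub r hr) y s
  · refine ContinuousOn.intervalIntegrable ?_
    exact (hv.continuousOn_energyDensityDeriv hβ y).comp (f := fun r => (r, s)) (by fun_prop)
      fun r hr => ⟨hsub r hr, mem_univ _⟩

/-- Fubini puts the s-integral inside, where integration by parts is available at each fixed r. -/
theorem IsHyperbolicKGSolution.integral_energyDensity_sub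
    (hv : IsHyperbolicKGSolution α₀ β₀ β T v) (hβ : ContDiff ℝ 1 β) (hρ : ρ ∈ Icc 1 T) (y : ℝ) :
    ∫ s in (-1 : ℝ)..1, (1 - s ^ 2) * (energyDensity α₀ β₀ β v ρ (y + (√ρ)⁻¹ * s)
        - energyDensity α₀ β₀ β v 1 (y + (√1)⁻¹ * s)) =
      ∫ r in (1 : ℝ)..ρ, ∫ s in (-1 : ℝ)..1, (1 - s ^ 2) * energyDensityDeriv α₀ β₀ β v y r s := by
  rw [intervalIntegral_intervalIntegral_swap
    (F := fun r s => (1 - s ^ 2) * energyDensityDeriv α₀ β₀ β v y r s) ?_]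
  · refine intervalIntegral.integral_congr fun s _ => ?_
    rw [hv.energyDensity_sub hβ hρ y s, intervalIntegral.integral_const_mul]
  · have hc : ContinuousOn (Function.uncurry fun r s : ℝ => (1 - s ^ 2) *
        energyDensityDeriv α₀ β₀ β v y r s) (Icc 1 ρ ×ˢ Icc (-1) 1) := by
      refine ContinuousOn.mul (f := fun p : ℝ × ℝ => 1 - p.2 ^ 2) (by fun_prop)
        ((hv.continuousOn_energyDensityDeriv hβ y).mono ?_)
      rintro ⟨r, s⟩ ⟨hr, -⟩
      exact ⟨⟨hr.1, hr.2.trans hρ.2⟩, mem_univ _⟩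
    refine (hc.integrableOn_compact (isCompact_Icc.prod isCompact_Icc)).mono_set ?_
    rw [uIoc_of_le hρ.1, uIoc_of_le (by norm_num)]
    exact prod_mono Ioc_subset_Icc_self Ioc_subset_Icc_self

theorem IsHyperbolicKGSolution.continuous_energyDensity
    (hv : IsHyperbolicKGSolution α₀ β₀ β T v) (hβ : ContDiff ℝ 1 β) (hρ : ρ ∈ Icc 1 T) :
    Continuous (energyDensity α₀ β₀ β v ρ) := by
  obtain ⟨h1, h2, -⟩ := hv.contDiff_slices hρ
  have h3 := h1.continuous
  have h4 := h2.continuous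
  have h5 := hβ.continuous
  have h6 := Real.continuous_sinh
  unfold energyDensity
  fun_prop

/-- The factors ρ^(-1/2) and ρ⁻¹ of the cubic and quartic potentials absorb the growth ρ^(3δ) and
ρ^(4δ). -/
theorem abs_energyDensity_sub_le {A K δ y : ℝ} (hδ : δ ≤ 1 / 8) (hA : 1 ≤ A) (hK : 0 ≤ K)
    (hα : |α₀| ≤ A) (hB : ∀ x, |β₀ + β x| ≤ A) (hρ : 1 ≤ ρ) (hy : |v ρ y| ≤ 2 * (K * ρ ^ δ)) :
    |energyDensity α₀ β₀ β v ρ y - 1 / 2 * (dRho v ρ y ^ 2 + v ρ y ^ 2)| ≤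
      7 * A * (K ^ 2 + K ^ 4) := by
  have hρ0 : 0 < ρ := by linarith
  have hs : 1 ≤ √ρ := Real.one_le_sqrt.mpr hρ
  have hw1 : (√ρ)⁻¹ ≤ 1 := inv_le_one_of_one_le₀ hs
  have hw0 : 0 < (√ρ)⁻¹ := by positivity
  have e3 := pow_mul_inv_sqrt_le hρ hδ 3 (by norm_num)
  have e4 := pow_mul_inv_sqrt_le hρ hδ 4 (by norm_num)
  have hx : 0 < ρ ^ δ := by positivity
  simp only [energyDensity]
  generalize (√ρ)⁻¹ = w at *
  generalize ρ ^ δ = x at *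
  have h3 : |α₀ * w * v ρ y ^ 3| ≤ A * (8 * K ^ 3) := by
    calc _ = |α₀| * (w * |v ρ y| ^ 3) := by simp only [abs_mul, abs_pow, abs_of_pos hw0]; ring
      _ ≤ A * (w * (2 * (K * x)) ^ 3) := by gcongr
      _ = A * (8 * K ^ 3 * (x ^ 3 * w)) := by ring
      _ ≤ A * (8 * K ^ 3 * 1) := by gcongr
      _ = _ := by ring
  have h4 : |(β₀ + β (ρ * Real.sinh y)) * w ^ 2 * v ρ y ^ 4| ≤ A * (16 * K ^ 4) := by
    calc _ = |β₀ + β (ρ * Real.sinh y)| * (w ^ 2 * |v ρ y| ^ 4) := by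
          simp only [abs_mul, abs_pow, abs_of_pos hw0]; ring
      _ ≤ A * (w ^ 2 * (2 * (K * x)) ^ 4) := by gcongr; exact hB _
      _ = A * (16 * K ^ 4 * ((x ^ 4 * w) * w)) := by ring
      _ ≤ A * (16 * K ^ 4 * (1 * 1)) := by gcongr
      _ = _ := by ring
  have hK3 : K ^ 3 ≤ K ^ 2 + K ^ 4 := by
    have h : 0 ≤ K ^ 2 * (K - 1) ^ 2 + K ^ 3 := by positivity
    linarith
  have hAK3 : A * K ^ 3 ≤ A * (K ^ 2 + K ^ 4) := by gcongr
  have hAK4 : 0 ≤ A * K ^ 2 := by positivity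
  have hAK5 : 0 ≤ A * K ^ 4 := by positivity
  have k3 := abs_le.mp h3
  have k4 := abs_le.mp h4
  rw [abs_le]
  constructor <;> linarith

theorem sq_le_two_mul_sq_add {f : ℝ → ℝ} (hf : ContDiff ℝ 1 f) {M Q w s y : ℝ} (hM : 0 ≤ M)
    (h : eLpNorm (deriv f) 2 volume ≤ ENNReal.ofReal M) (hs : |s| ≤ 1) (hw : 0 ≤ w)
    (hQ : w * M ^ 2 ≤ Q) : f y ^ 2 ≤ 2 * f (y + w * s) ^ 2 + 2 * Q := by
  have h1 := abs_sub_le_sqrt_mul hf hM h y (y + w * s)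
  have h2 : (f (y + w * s) - f y) ^ 2 ≤ w * M ^ 2 := by
    rw [← sq_abs]
    calc _ ≤ (√|y + w * s - y| * M) ^ 2 := by gcongr
      _ = |w * s| * M ^ 2 := by rw [mul_pow, Real.sq_sqrt (abs_nonneg _), add_sub_cancel_left]
      _ ≤ w * M ^ 2 := by
        gcongr
        rw [abs_mul, abs_of_nonneg hw]
        exact mul_le_of_le_one_right hw hs
  nlinarith [sq_nonneg (2 * f (y + w * s) - f y)]

end

/-- The uniform bound for `v` and `∂_ρ v`. -/
theorem exists_uniform_bound (α₀ β₀ : ℝ) (β : 𝓢(ℝ, ℝ)) {δ : ℝ} (hδ : δ < 1 / 8) :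
    ∃ C : ℝ, 0 ≤ C ∧ ∀ (T : ℝ) (v : ℝ → ℝ → ℝ) (K : ℝ), 0 ≤ K →
      IsHyperbolicKGSolution α₀ β₀ (fun x => β x) T v →
      (∀ ρ ∈ Icc 1 T, energyNorm v ρ ≤ ENNReal.ofReal (K * ρ ^ δ)) →
      ∀ ρ ∈ Icc 1 T, ∀ y, |v ρ y| ≤ C * (K * (1 + K ^ 2)) ∧
        |dRho v ρ y| ≤ C * (K * (1 + K ^ 2)) := by
  obtain ⟨A, hA, hα, hB, hX, hY⟩ := exists_coefficient_bound α₀ β₀ β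
  -- The energy derivative is O(r^(-1-ε)); its integrability is where δ < 1/8 must be strict.
  set ε := 1 / 4 - 2 * δ with hε
  have hε0 : 0 < ε := by linarith
  -- This is 3/2 · (2 · 704/ε + 37 · 4/3) · A, with 704 = 44 · 16 and 3/2 the inverse of 1/2 · ∫ (1
  -- - s²).
  set C2 := (2112 / ε + 74) * A with hC2
  have hC20 : 0 ≤ C2 := by positivity
  refine ⟨√C2, by positivity, fun T v K hK hv hE ρ hρ y => ?_⟩
  have hβ : ContDiff ℝ 1 (fun x => β x) := β.smooth 1
  set Q := K ^ 2 + K ^ 4 with hQ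
  have hQ0 : 0 ≤ Q := by positivity
  have hρ0 : 0 < ρ := by linarith [hρ.1]
  have h1T : (1 : ℝ) ∈ Icc 1 T := ⟨le_rfl, hρ.1.trans hρ.2⟩
  have hdiff : |∫ s in (-1 : ℝ)..1, (1 - s ^ 2) *
      (energyDensity α₀ β₀ (fun x => β x) v ρ (y + (√ρ)⁻¹ * s)
        - energyDensity α₀ β₀ (fun x => β x) v 1 (y + (√1)⁻¹ * s))| ≤ 704 * A * Q * (1 / ε) := by
    rw [hv.integral_energyDensity_sub hβ hρ y, ← Real.norm_eq_abs]
    calc _ ≤ ∫ r in (1 : ℝ)..ρ, 704 * A * Q * r ^ (-1 - ε) := by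
          refine intervalIntegral.norm_integral_le_of_norm_le hρ.1 (ae_of_all _ fun r hr => ?_) ?_
          · have hrT : r ∈ Icc 1 T := ⟨hr.1.le, hr.2.trans hρ.2⟩
            have hr0 : 0 < r := by linarith [hr.1]
            refine (hv.abs_integral_energyDensityDeriv_le hβ hA hα hB hX hY hrT
              (by positivity) (hE r hrT) (Real.rpow_pos_of_pos hr0 (-(1 / 4)))
              (sq_rpow_neg_quarter hr0) y).trans ?_
            have h1 := majorant_le_rpow (K := K) hrT.1 hδ.le
            have h2 : 2 * δ - 5 / 4 = -1 - ε := by rw [hε]; ring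
            rw [h2] at h1
            calc _ ≤ 44 * A * (16 * Q * r ^ (-1 - ε)) := by gcongr
              _ = _ := by ring
          · refine (intervalIntegral.intervalIntegrable_rpow (Or.inr ?_)).const_mul _
            rw [uIcc_of_le hρ.1]; intro h; linarith [h.1]
      _ ≤ _ := by
          rw [intervalIntegral.integral_const_mul]
          gcongr
          exact integral_rpow_le hε0 hρ.1
  -- The constant is 37 = 14 + 14 + 8 + 1: potential terms at ρ and at 1, quadratic energy at 1,
  -- oscillation in the window.
  have hpoint : ∀ s ∈ Icc (-1 : ℝ) 1, ∀ m : ℝ, (m = v ρ y ∨ m = dRho v ρ y) →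
      (1 - s ^ 2) * (1 / 2 * m ^ 2) ≤ 2 * ((1 - s ^ 2) *
      (energyDensity α₀ β₀ (fun x => β x) v ρ (y + (√ρ)⁻¹ * s)
        - energyDensity α₀ β₀ (fun x => β x) v 1 (y + (√1)⁻¹ * s))) +
        37 * A * Q * (1 - s ^ 2) := by
    intro s hs m hm
    have hs1 : |s| ≤ 1 := abs_le.mpr hs
    have hφ : 0 ≤ 1 - s ^ 2 := by
      have : s ^ 2 ≤ 1 := by rw [← sq_abs]; exact pow_le_one₀ (abs_nonneg s) hs1
      linarith
    obtain ⟨a1, a2⟩ := hv.abs_le_of_energyNorm_le h1T (by positivity) (hE 1 h1T) (y + (√1)⁻¹ * s)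
    obtain ⟨b1, -⟩ := hv.abs_le_of_energyNorm_le hρ (by positivity) (hE ρ hρ) (y + (√ρ)⁻¹ * s)
    have d1 := abs_le.mp (abs_energyDensity_sub_le hδ.le hA hK hα hB le_rfl a1)
    have d2 := abs_le.mp (abs_energyDensity_sub_le hδ.le hA hK hα hB hρ.1 b1)
    rw [Real.one_rpow, mul_one] at a1 a2
    have a1' := sq_le_sq' (by linarith [(abs_le.mp a1).1]) (abs_le.mp a1).2
    have a2' := sq_le_sq' (by linarith [(abs_le.mp a2).1]) (abs_le.mp a2).2
    have hwQ : (√ρ)⁻¹ * (K * ρ ^ δ) ^ 2 ≤ Q := by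
      have := pow_mul_inv_sqrt_le hρ.1 hδ.le 2 (by norm_num)
      calc _ = K ^ 2 * ((ρ ^ δ) ^ 2 * (√ρ)⁻¹) := by ring
        _ ≤ K ^ 2 * 1 := by gcongr
        _ ≤ Q := by rw [hQ]; linarith [pow_nonneg hK 4]
    obtain ⟨-, n2, -, n4, -⟩ := eLpNorm_le_of_energyNorm_le (hE ρ hρ)
    obtain ⟨s1, s2, -⟩ := hv.contDiff_slices hρ
    have hm2 : m ^ 2 ≤ 2 * (dRho v ρ (y + (√ρ)⁻¹ * s) ^ 2 + v ρ (y + (√ρ)⁻¹ * s) ^ 2) + 2 * Q := by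
      rcases hm with rfl | rfl
      · have := sq_le_two_mul_sq_add (s1.of_le (by exact_mod_cast le_top)) (y := y) (by positivity)
          n2 hs1 (by positivity) hwQ
        linarith [sq_nonneg (dRho v ρ (y + (√ρ)⁻¹ * s))]
      · have := sq_le_two_mul_sq_add (s2.of_le (by exact_mod_cast le_top)) (y := y) (by positivity)
          n4 hs1 (by positivity) hwQ
        linarith [sq_nonneg (v ρ (y + (√ρ)⁻¹ * s))]
    have hQA : Q ≤ A * Q := le_mul_of_one_le_left hQ0 hA
    have hK2 : K ^ 2 ≤ Q := by rw [hQ]; linarith [pow_nonneg hK 4]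
    rw [← hQ] at d1 d2
    calc _ ≤ (1 - s ^ 2) * (2 *
      (energyDensity α₀ β₀ (fun x => β x) v ρ (y + (√ρ)⁻¹ * s)
        - energyDensity α₀ β₀ (fun x => β x) v 1 (y + (√1)⁻¹ * s)) + 37 * A * Q) := by
          gcongr
          linarith
      _ = _ := by ring
  have hfin : ∀ m : ℝ, (m = v ρ y ∨ m = dRho v ρ y) → |m| ≤ √C2 * (K * (1 + K ^ 2)) := by
    intro m hm
    have c1 := hv.continuous_energyDensity hβ hρ
    have c2 := hv.continuous_energyDensity hβ h1T
    have h1 := intervalIntegral.integral_mono_on (μ := volume) (a := (-1 : ℝ)) (b := 1)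
      (by norm_num) (Continuous.intervalIntegrable (by fun_prop) _ _)
      (Continuous.intervalIntegrable (by fun_prop) _ _) (fun s hs => hpoint s hs m hm)
    rw [intervalIntegral.integral_mul_const, intervalIntegral.integral_add
      (Continuous.intervalIntegrable (by fun_prop) _ _)
      (Continuous.intervalIntegrable (by fun_prop) _ _), intervalIntegral.integral_const_mul,
      intervalIntegral.integral_const_mul, integral_weight] at h1
    have h2 := (le_abs_self _).trans hdiff
    have h3 : m ^ 2 ≤ C2 * Q := by
      have : C2 * Q = 3 / 2 * (2 * (704 * A * Q * (1 / ε)) + 37 * A * Q * (4 / 3)) := by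
        rw [hC2]; ring
      rw [this]; linarith
    refine abs_le_of_sq_le_sq ?_ (by positivity)
    calc m ^ 2 ≤ C2 * Q := h3
      _ ≤ C2 * (K * (1 + K ^ 2)) ^ 2 := by
          gcongr
          have : 0 ≤ K ^ 4 + K ^ 6 := by positivity
          linarith
      _ = _ := by rw [mul_pow (√C2), Real.sq_sqrt hC20]
  exact ⟨hfin _ (Or.inl rfl), hfin _ (Or.inr rfl)⟩

/-! ### From sup bounds to the Besov norms -/

theorem eLpNorm_const_mul_le {g : ℝ → ℝ} {c r M : ℝ} (hc : 0 ≤ c) (hr : 0 < r)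
    (h : eLpNorm (fun y => r⁻¹ * g y) 2 volume ≤ ENNReal.ofReal M) :
    eLpNorm (fun y => c * g y) 2 volume ≤ ENNReal.ofReal (c * (r * M)) := by
  have h1 : (fun y => c * g y) = (c * r) • fun y => r⁻¹ * g y := by
    ext y
    simp only [Pi.smul_apply, smul_eq_mul]
    field_simp
  rw [h1, eLpNorm_const_smul, ← mul_assoc, ENNReal.ofReal_mul (by positivity : 0 ≤ c * r),
    Real.enorm_of_nonneg (by positivity)]
  gcongr

theorem energyNorm_le_of_energyGrowth {δ T : ℝ} {v : ℝ → ℝ → ℝ} (h : energyGrowth δ T v < ⊤)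
    {ρ : ℝ} (hρ : ρ ∈ Icc 1 T) :
    energyNorm v ρ ≤ ENNReal.ofReal ((energyGrowth δ T v).toReal * ρ ^ δ) := by
  have hρ0 : 0 < ρ := by linarith [hρ.1]
  have h1 : ENNReal.ofReal (ρ ^ (-δ)) * energyNorm v ρ ≤ energyGrowth δ T v :=
    le_iSup₂ (f := fun ρ (_ : ρ ∈ Icc 1 T) => ENNReal.ofReal (ρ ^ (-δ)) * energyNorm v ρ) ρ hρ
  rw [ENNReal.ofReal_mul ENNReal.toReal_nonneg, ENNReal.ofReal_toReal h.ne]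
  calc energyNorm v ρ = ENNReal.ofReal (ρ ^ (-δ)) * energyNorm v ρ * ENNReal.ofReal (ρ ^ δ) := by
        rw [mul_right_comm, ← ENNReal.ofReal_mul (by positivity), ← Real.rpow_add hρ0]
        simp
    _ ≤ _ := by gcongr

theorem mainTheorem3 (α₀ β₀ : ℝ) (β : 𝓢(ℝ, ℝ)) (δ : ℝ) (hδ_pos : 0 < δ) (hδ_lt : δ < 1 / 8)
    (P : LittlewoodPaley) :
    ∃ C : ℝ≥0, ∀ (T : ℝ) (v : ℝ → ℝ → ℝ), 1 ≤ T →
      IsHyperbolicKGSolution α₀ β₀ (fun x => β x) T v →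
      energyGrowth δ T v < ⊤ →
      (⨆ ρ ∈ Icc 1 T, decayNorm P δ v ρ) ≤
        (C : ℝ≥0∞) * energyGrowth δ T v * (1 + energyGrowth δ T v ^ 2) := by
  obtain ⟨C, hC0, hC⟩ := exists_uniform_bound α₀ β₀ β hδ_lt
  obtain ⟨D, hD0, hD⟩ := P.exists_besovNorm_le
  -- v and v̇ contribute C + 1 each, and the weighted ∂_y v contributes 3: its sup gives 2 and its
  -- L² derivative term 1.
  refine ⟨(D * (2 * C + 5)).toNNReal, fun T v _ hv hfin => ?_⟩
  set K := (energyGrowth δ T v).toReal with hK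
  have hK0 : 0 ≤ K := ENNReal.toReal_nonneg
  have hE : ∀ ρ ∈ Icc 1 T, energyNorm v ρ ≤ ENNReal.ofReal (K * ρ ^ δ) :=
    fun ρ hρ => energyNorm_le_of_energyGrowth hfin hρ
  have hKe : energyGrowth δ T v = ENNReal.ofReal K := (ENNReal.ofReal_toReal hfin.ne).symm
  have hrhs : ((D * (2 * C + 5)).toNNReal : ℝ≥0∞) * energyGrowth δ T v *
      (1 + energyGrowth δ T v ^ 2) = ENNReal.ofReal (D * (2 * C + 5) * K * (1 + K ^ 2)) := by
    rw [hKe, ENNReal.ofReal_mul (by positivity), ENNReal.ofReal_mul (by positivity),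
      ENNReal.ofReal_add (by norm_num) (by positivity), ENNReal.ofReal_pow hK0,
      ENNReal.ofReal_one]
    rfl
  rw [hrhs]
  refine iSup₂_le fun ρ hρ => ?_
  have hρ0 : 0 < ρ := by linarith [hρ.1]
  set L := K * (1 + K ^ 2) with hL
  have hKL : K ≤ L := by rw [hL]; linarith [pow_nonneg hK0 3]
  have hb := hC T v K hK0 hv hE ρ hρ
  obtain ⟨-, n2, -, n4, n5⟩ := eLpNorm_le_of_energyNorm_le (hE ρ hρ)
  obtain ⟨s1, s2, s3⟩ := hv.contDiff_slices hρ
  replace s1 : ContDiff ℝ 1 (v ρ) := s1.of_le (by exact_mod_cast le_top)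
  replace s2 : ContDiff ℝ 1 (dRho v ρ) := s2.of_le (by exact_mod_cast le_top)
  replace s3 : ContDiff ℝ 1 (dY v ρ) := s3.of_le (by exact_mod_cast le_top)
  have hdiff3 : Differentiable ℝ (dY v ρ) := s3.differentiable (by norm_num)
  have hder : ∀ c : ℝ, (deriv fun y => c * dY v ρ y) = fun y => c * deriv (dY v ρ) y :=
    fun c => funext fun y => deriv_const_mul c (hdiff3 y)
  have hM0 : 0 ≤ K * ρ ^ δ := by positivity
  have hsm : (√ρ)⁻¹ * (K * ρ ^ δ) ≤ K := by
    have := pow_mul_inv_sqrt_le hρ.1 hδ_lt.le 1 (by norm_num)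
    rw [pow_one] at this
    calc _ = K * (ρ ^ δ * (√ρ)⁻¹) := by ring
      _ ≤ K * 1 := by gcongr
      _ = K := mul_one K
  have hlow : ∀ f : ℝ → ℝ, ContDiff ℝ 1 f → (∀ y, |f y| ≤ C * L) →
      eLpNorm (deriv f) 2 volume ≤ ENNReal.ofReal (K * ρ ^ δ) →
      P.besovNorm ρ f ≤ ENNReal.ofReal (D * (C * L + L)) := by
    intro f hf hfb hfd
    refine (hD ρ hρ.1 f hf _ _ hM0 hfb hfd).trans (ENNReal.ofReal_le_ofReal ?_)
    gcongr
    linarith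
  have t1 := hlow (v ρ) s1 (fun y => (hb y).1) n2
  have t2 := hlow (dRho v ρ) s2 (fun y => (hb y).2) n4
  have t3 : P.besovNorm ρ (fun y => ρ ^ (-(1 / 2) - δ) * dY v ρ y) ≤
      ENNReal.ofReal (D * (3 * L)) := by
    have hsq : √ρ * √ρ = ρ := Real.mul_self_sqrt hρ0.le
    have hs0 : 0 < √ρ := Real.sqrt_pos.mpr hρ0
    have hx : ρ ^ (-(1 / 2) - δ) * (√ρ * ρ ^ δ) = 1 := by
      rw [Real.sqrt_eq_rpow, ← Real.rpow_add hρ0, ← Real.rpow_add hρ0]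
      convert Real.rpow_zero ρ using 2
      ring
    have hc0 : 0 ≤ ρ ^ (-(1 / 2) - δ) := by positivity
    rw [hder] at n5
    have hsup : ∀ y, |ρ ^ (-(1 / 2) - δ) * dY v ρ y| ≤ 2 * K := by
      intro y
      have e1 := eLpNorm_const_mul_le (c := 1) zero_le_one hρ0 n5
      simp only [one_mul] at e1
      -- At scale ρ⁻¹ the bounds ‖∂_y v‖ ≤ K ρ^δ and ‖∂_y² v‖ ≤ ρ K ρ^δ contribute equally.
      have e2 := abs_le_div_sqrt_add s3 hM0 (by positivity) (inv_pos.mpr hρ0) n2 e1 y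
      rw [Real.sqrt_inv, div_inv_eq_mul] at e2
      have e3 : (√ρ)⁻¹ * (ρ * (K * ρ ^ δ)) = √ρ * (K * ρ ^ δ) := by
        nth_rewrite 2 [← hsq]; field_simp
      rw [e3] at e2
      rw [abs_mul, abs_of_nonneg hc0]
      calc _ ≤ ρ ^ (-(1 / 2) - δ) * (K * ρ ^ δ * √ρ + √ρ * (K * ρ ^ δ)) := by gcongr
        _ = 2 * K * (ρ ^ (-(1 / 2) - δ) * (√ρ * ρ ^ δ)) := by ring
        _ = 2 * K := by rw [hx, mul_one]
    have hd3 := eLpNorm_const_mul_le hc0 hρ0 n5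
    rw [← hder] at hd3
    refine (hD ρ hρ.1 _ (contDiff_const.mul s3) _ _ (by positivity) hsup hd3).trans
      (ENNReal.ofReal_le_ofReal ?_)
    have e4 : (√ρ)⁻¹ * (ρ ^ (-(1 / 2) - δ) * (ρ * (K * ρ ^ δ))) = K := by
      calc _ = (√ρ)⁻¹ * ρ * ρ ^ (-(1 / 2) - δ) * ρ ^ δ * K := by ring
        _ = √ρ * ρ ^ (-(1 / 2) - δ) * ρ ^ δ * K := by
          congr 3
          nth_rewrite 2 [← hsq]; field_simp
        _ = (ρ ^ (-(1 / 2) - δ) * (√ρ * ρ ^ δ)) * K := by ring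
        _ = K := by rw [hx, one_mul]
    rw [e4]
    gcongr
    linarith
  calc decayNorm P δ v ρ ≤ ENNReal.ofReal (D * (C * L + L)) + ENNReal.ofReal (D * (C * L + L)) +
        ENNReal.ofReal (D * (3 * L)) := add_le_add (add_le_add t1 t2) t3
    _ = ENNReal.ofReal (D * (2 * C + 5) * K * (1 + K ^ 2)) := by
        have hL0 : 0 ≤ L := hK0.trans hKL
        rw [← ENNReal.ofReal_add (by positivity) (by positivity),
          ← ENNReal.ofReal_add (by positivity) (by positivity)]
        congr 1
        rw [hL]; ring
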